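/- **Setting.** Let $\mathcal U\subset\mathbb R^N$ be open and consider a strictly hyperbolic system $q(u)_t+f(u)_x=0$, $u\in\mathcal U$, with $q,f\in C^2$, $Dq$ invertible, characteristic speeds $\lambda_1<\dots<\lambda_N$ and $C^1$ eigenvector fields, $Df\,r_k=\lambda_k\,Dq\,r_k$; each field is genuinely nonlinear (GNL, $r_k\cdot\nabla\lambda_k>0$ on $\mathcal U$) or linearly degenerate (LD, $r_k\cdot\nabla\lambda_k=0$ on $\mathcal U$). Let $W_k(u,\zeta)$ be the flow of $r_k$ in $\mathcal U$ (simple waves), and let $S_k(u)$ be the set of right states of $k$-shocks with left state $u$, given by the Rankine–Hugoniot and Lax conditions; assume moreover that $\sigma_k(u_\ell,u_m)<\sigma_{k'}(u_m,u_r)$ for the speeds of shocks of families $k<k'$ with common middle state $u_m$. Let $E_k(u,\zeta)$ be an elementary wave curve: it is $W_k(u,\zeta)$ if $k$ is LD or $\zeta\ge0$, and for GNL $k$ its part $\zeta<0$ is a parameterization of $S_k(u)$ by a real interval which contains all small negative $\zeta$ locally uniformly in $u$; $E_k$ is $C^1$ near $\zeta=0$. Assume that the generalized Riemann problem (gRP)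 is globally uniquely solvable: for all $u_L,u_R\in\mathcal U$ and all widths $w_k\ge0$, with $w_k=0$ for LD $k$, there are unique $\zeta_1,\dots,\zeta_N$ such that $u_0=u_L$ and $u_k=E_k(u_{k-1},\zeta_k)$ if $w_k=0$, $u_k=W_k(u_{k-1},\zeta_k)$ if $w_k>0$, lead to $u_N=u_R$. **The scheme.** Fix $\epsilon>0$, positive exponents $e_r,e_c,e_w,e_p,e_d,e_i$, and $0<\kappa<1/3$, $0<Q<1$ with $\epsilon^{e_p}<\kappa\,\epsilon^{e_r}$, and constants $C$ and $K_A$. A modified front tracking (mFT) approximation consists of interaction times $0=t_0<t_1\le t_2\le\cdots$ and, on each interval $(t_i,t_{i+1})$, a finite ordered sequence of jumps moving at constant speeds at distinct positions; if no further interaction occurs after $t_i$ then $t_{i+1}=\infty$. A jump is a wave (with its strength $\zeta$, family $k$, exact adjacent states, and preconditioner $A$, where $|A|,|A^{-1}|\le K_A$), or a composite of superposed waves, one of which is its carrier and the others its passengers. It has a virtual center $(x^c,t^c)$ and the virtual width $w(t)=(\lambda_k(u_{\rm right})-\lambda_k(u_{\rm left}))(t-t^c)$ if its carrier is a simple $k$-wave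 with states $u_{\rm left},u_{\rm right}$, and width $0$ if its carrier is a shock or a contact. Its virtual edges are the lines $x^c+\lambda_k(u_{\rm left})(t-t^c)$ and $x^c+\lambda_k(u_{\rm right})(t-t^c)$. With $[g]=g(u_{\rm right})-g(u_{\rm left})$ for a wave, the least squares speed of a set of superposed waves is a minimizer $s$ of $|\sum A([f]-s[q])|$. *Initialization.* The data $u^0$ are $BV$, have one-sided limits in $\mathcal U$, are the average of these limits, and are constant outside a compact interval. Choose a finite grid spanning this interval which contains all points with $|u^0(x+)-u^0(x-)|\ge\epsilon^{e_d}$ and on which the variation of $u^0$ is attained up to $\epsilon^{e_i}$. At each grid point solve the Riemann problem ($w=0$) exactly, splitting centered rarefactions stronger than $\epsilon^{e_r}$ as below. Between consecutive grid points $a<b$ solve the gRP with states $u^0(a+),u^0(b-)$ and with $w_k>0$ for all GNL $k$, $\sum w_k<b-a$, placed inside $[a,b]$; its GNL waves are to be weaker than $\epsilon^{e_d}$. Replace each wave by one jump with least squares speed through the exact center, whose width may then be reduced by a factor in $(0,1]$. Waves of zero strength are always omitted. *Interactions.* The next interaction time is the first time at which jumps meet, or a compression has width $0$ and collapses, or a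 multi-rarefaction ends. When jumps meet, or when a compression collapses, at $(x^!,t^!)$, widths $w'_k\ge0$ are chosen for the emerging waves ($w'_k=0$ for LD $k$) that exceed neither the largest incident width nor the width of any incident $k$-wave; at a collapse of a single compression $w'=0$. The gRP with the outer states of the incident waves and widths $w'$ is solved exactly, where $w'$ must be such that all emerging simple waves with $\zeta<0$ (compressions) have $-\epsilon^{e_c}\le\zeta\le-\epsilon^{e_w}$ (others are made shocks by taking $w'_k=0$). The virtual center of an emerging simple wave is at the time $t^c=t^!-w'_k/(\lambda_k(u_k)-\lambda_k(u_{k-1}))$. GNL rarefactions with $\zeta>\epsilon^{e_r}$ are split along $W_k$ into rarefactions with strengths in $[\kappa\epsilon^{e_r},\epsilon^{e_r}]$ (for $w'_k>0$ this is allowed for $\zeta=\epsilon^{e_r}$ also); if $w'_k=0$ the pieces are centered at $(x^!,t^!)$; if $w'_k>0$ they form a multi-rarefaction: $2m+1\ge3$ pieces with strengths symmetric about the middle one, with common virtual center $(x^c,t^c)$, $x^c=x^!-\lambda_k(\bar u)(t^!-t^c)$, $\bar u=W_k(u_{k-1},\zeta/2)$, which start from $(x^!,t^!)$ with temporary constant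 speeds such that each meets its target line $x^c+s(t-t^c)$ at a common time $t^\#>t^!$ with $t^!-t^c\le C m\,\epsilon^{e_r}(t^\#-t^!)$, and then gets its target speed $s$. *Composite waves.* Emerging waves with $|\zeta|\ge\epsilon^{e_p}$ are carriers. If there are such waves, every weaker emerging wave is a passenger of the nearest carrier on its left or right, the stronger one if there are both (for equal strengths the assignment may not cross); if there are none, all emerging waves form one composite, carried by the strongest. A composite moves as one jump and has the width and center of its carrier. Its speed $s$ (the target speed, in a multi-rarefaction) is the least squares speed of its carrier if all passengers have $|\zeta_{\rm pass}|\le Q|\zeta_{\rm carrier}|$, and of the whole composite otherwise. The speeds of the emerging jumps are strictly increasing from left to right. *Avoidance of overlaps.* If an outermost emerging jump and the next, not interacting jump on that side have simple carriers of the same family, and the facing virtual edge of the latter reaches $x^!$, then the width of the latter is reduced (same position and speed) so that this edge no longer reaches $x^!$; afterwards the two must not overlap. Jumps in the transient phase of a multi-rarefaction are not narrowed. The approximation is $U^\epsilon(x,t)=u_0+\sum_j[u]_jH(x-x_j(t))$, $0\le t<t_\infty:=\sup_it_i$, where $H$ is the Heaviside function with $H(0)=\frac12$ and $u_0$ is the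 value of the data near $-\infty$. It satisfies the *$\alpha$-ray condition* at $(x_*,t_*)$ if the limit $$V_\alpha=\lim_{t\to t_*^-}U^\epsilon\big(x_*+\alpha(t-t_*),t\big)$$ exists in $\mathcal U$, uniformly for $\alpha$ in compact intervals; here "in $\mathcal U$" means that for every compact interval $I$ there is a compact $K\subset\mathcal U$ with $V_\alpha\in K$ for almost every $\alpha\in I$. **Statement.** Let $U^\epsilon$ be an mFT approximation such that the speeds of all its jumps are bounded in absolute value by some $\Lambda<\infty$, and let $t_\infty<\infty$. If the total variation of $U^\epsilon(\cdot,t)$ tends to $\infty$ as $t\to t_\infty^-$, then there is a point $x_\infty\in\mathbb R$ such that the $\alpha$-ray condition fails at $(x_\infty,t_\infty)$. -/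

import Mathlib

open Set Filter Topology
open scoped ENNReal

noncomputable section

/-- States are vectors of `ℝ^N` with the Euclidean norm. -/
abbrev State (N : ℕ) := EuclideanSpace ℝ (Fin N)

/-! ## The system of conservation laws `q(u)_t + f(u)_x = 0` -/

/-- A strictly hyperbolic `N × N` system of conservation laws, each of whose fields is genuinely
nonlinear or linearly degenerate. The eigenvector fields are normalised by
`r_k · ∇ λ_k > 0` in the genuinely nonlinear case. -/
structure ConservationLaw (N : ℕ) where
  /-- the state space -/
  states : Set (State N)
  isOpen_states : IsOpen states
  /-- conserved quantities -/
  q : State N → State N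
  /-- fluxes -/
  f : State N → State N
  contDiffOn_q : ContDiffOn ℝ 2 q states
  contDiffOn_f : ContDiffOn ℝ 2 f states
  injective_fderiv_q : ∀ u ∈ states, Function.Injective (fderiv ℝ q u)
  /-- characteristic speeds -/
  lam : Fin N → State N → ℝ
  /-- eigenvector fields -/
  r : Fin N → State N → State N
  contDiffOn_lam : ∀ k, ContDiffOn ℝ 1 (lam k) states
  contDiffOn_r : ∀ k, ContDiffOn ℝ 1 (r k) states
  r_ne_zero : ∀ k, ∀ u ∈ states, r k u ≠ 0
  eigen : ∀ k, ∀ u ∈ states, fderiv ℝ f u (r k u) = lam k u • fderiv ℝ q u (r k u)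
  strictly_hyperbolic : ∀ i k, i < k → ∀ u ∈ states, lam i u < lam k u
  gnl_or_linDeg : ∀ k, (∀ u ∈ states, 0 < fderiv ℝ (lam k) u (r k u)) ∨
    (∀ u ∈ states, fderiv ℝ (lam k) u (r k u) = 0)

namespace ConservationLaw

variable {N : ℕ}

/-- The `k`-th field is genuinely nonlinear. -/
def GNL (S : ConservationLaw N) (k : Fin N) : Prop :=
  ∀ u ∈ S.states, 0 < fderiv ℝ (S.lam k) u (S.r k u)

/-- The `k`-th field is linearly degenerate. -/
def LinDeg (S : ConservationLaw N) (k : Fin N) : Prop :=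
  ∀ u ∈ S.states, fderiv ℝ (S.lam k) u (S.r k u) = 0

/-- `uR = W_k(uL, ζ)`: the integral curve of `dU/dζ = r_k(U)` which starts in `uL` exists in the
state space up to the parameter `ζ` (of either sign) and is then in `uR`. -/
def SimpleWave (S : ConservationLaw N) (k : Fin N) (uL : State N) (ζ : ℝ) (uR : State N) : Prop :=
  ∃ c : ℝ → State N, c 0 = uL ∧ c ζ = uR ∧
    ∀ z ∈ uIcc 0 ζ, c z ∈ S.states ∧ HasDerivWithinAt c (S.r k (c z)) (uIcc 0 ζ) z

/-- `uR ∈ S_k(uL)` with shock speed `σ`: the Rankine-Hugoniot condition and Lax's entropy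
condition. (By strict hyperbolicity it is the same to compare `σ` with the neighbouring families
only, or with all slower and all faster ones.) -/
def IsShock (S : ConservationLaw N) (k : Fin N) (uL uR : State N) (σ : ℝ) : Prop :=
  uL ∈ S.states ∧ uR ∈ S.states ∧ S.f uR - S.f uL = σ • (S.q uR - S.q uL) ∧
    σ < S.lam k uL ∧ S.lam k uR < σ ∧
    (∀ i, i < k → S.lam i uL < σ) ∧ (∀ i, k < i → σ < S.lam i uR)

end ConservationLaw

/-- A system together with a consistent parameterization `E_k(u, ζ)` of its elementary wave curves,
for each genuinely nonlinear family `k`: it is `W_k(u, ζ)` for `ζ ≥ 0` (rarefactions), and it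
parameterizes the admissible half `S_k(u)` of the shock curve by a set of negative `ζ`.
(For a linearly degenerate family the elementary wave curve is the whole simple wave curve.) -/
structure HyperbolicSystem (N : ℕ) extends ConservationLaw N where
  /-- the parameterization of the elementary wave curve -/
  E : Fin N → State N → ℝ → State N
  /-- the parameters of shocks -/
  shockDom : Fin N → State N → Set ℝ
  E_rarefaction : ∀ k, toConservationLaw.GNL k → ∀ u ζ v, 0 ≤ ζ →
    toConservationLaw.SimpleWave k u ζ v → E k u ζ = v
  shockDom_neg : ∀ k u, ∀ ζ ∈ shockDom k u, ζ < 0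
  ordConnected_shockDom : ∀ k u, (shockDom k u).OrdConnected
  continuousOn_E : ∀ k, toConservationLaw.GNL k → ∀ u ∈ states,
    ContinuousOn (E k u) (shockDom k u)
  E_shock : ∀ k, toConservationLaw.GNL k → ∀ u ∈ states,
    BijOn (E k u) (shockDom k u) {v | ∃ σ, toConservationLaw.IsShock k u v σ}
  /-- the curve consists of shocks for all small negative `ζ`, locally uniformly, ... -/
  shockDom_near : ∀ k, toConservationLaw.GNL k → ∀ u ∈ states,
    ∀ᶠ p : State N × ℝ in 𝓝 (u, 0), p.2 < 0 → p.2 ∈ shockDom k p.1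
  /-- ... and it is continuously differentiable there. -/
  contDiffAt_E : ∀ k, toConservationLaw.GNL k → ∀ u ∈ states,
    ContDiffAt ℝ 1 (fun p : State N × ℝ => E k p.1 p.2) (u, 0)
  /-- Lax's extended entropy condition: shocks of different families that have a common middle
  state do not overtake each other. -/
  extended_lax : ∀ k k', k < k' → ∀ uL uM uR σ σ',
    toConservationLaw.IsShock k uL uM σ → toConservationLaw.IsShock k' uM uR σ' → σ < σ'

namespace HyperbolicSystem

variable {N : ℕ}

/-- `uR = E_k(uL, ζ)`: the two states are joined by an elementary centered `k`-wave (contact,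
centered rarefaction or admissible shock) of strength `ζ`. -/
def Elementary (S : HyperbolicSystem N) (k : Fin N) (uL : State N) (ζ : ℝ) (uR : State N) : Prop :=
  ((S.LinDeg k ∨ 0 ≤ ζ) ∧ S.SimpleWave k uL ζ uR) ∨
    (S.GNL k ∧ uL ∈ S.states ∧ ζ ∈ S.shockDom k uL ∧ uR = S.E k uL ζ)

/-- The states `u 0, …, u N` solve a generalized Riemann problem with initial widths `w`: the
`k`-wave is elementary if `w k = 0`, and a simple wave if `w k > 0`. -/
def Chain (S : HyperbolicSystem N) (w ζ : Fin N → ℝ) (u : Fin (N + 1) → State N) : Prop :=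
  ∀ k : Fin N, (w k = 0 → S.Elementary k (u k.castSucc) (ζ k) (u k.succ)) ∧
    (0 < w k → S.SimpleWave k (u k.castSucc) (ζ k) (u k.succ))

/-- Admissible initial widths: nonnegative, and zero for linearly degenerate families. -/
def Widths (S : HyperbolicSystem N) (w : Fin N → ℝ) : Prop :=
  ∀ k, 0 ≤ w k ∧ (S.LinDeg k → w k = 0)

/-- The generalized Riemann problem is globally uniquely solvable in the state space. -/
def GRPSolvable (S : HyperbolicSystem N) : Prop :=
  ∀ w, S.Widths w → ∀ uL ∈ S.states, ∀ uR ∈ S.states,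
    ∃! ζ : Fin N → ℝ, ∃ u : Fin (N + 1) → State N,
      u 0 = uL ∧ u (Fin.last N) = uR ∧ S.Chain w ζ u

end HyperbolicSystem

/-! ## Discretization parameters -/

/-- The discretization parameter `ε` with the exponents of the various thresholds. -/
structure MFTParams where
  ε : ℝ
  er : ℝ
  ec : ℝ
  ew : ℝ
  ep : ℝ
  ed : ℝ
  ei : ℝ
  /-- relative minimum strength of a split rarefaction -/
  κ : ℝ
  /-- the value `Q(ε)` which separates light from heavy passengers -/
  Q : ℝ
  /-- the constant in the choice of the duration of a multi-rarefaction -/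
  Cmr : ℝ
  /-- bound on the preconditioners and their inverses -/
  KA : ℝ
  ε_pos : 0 < ε
  er_pos : 0 < er
  ec_pos : 0 < ec
  ew_pos : 0 < ew
  ep_pos : 0 < ep
  ed_pos : 0 < ed
  ei_pos : 0 < ei
  κ_pos : 0 < κ
  κ_lt : κ < 1 / 3
  Q_pos : 0 < Q
  Q_lt : Q < 1
  passenger_lt_split : ε ^ ep < κ * ε ^ er

namespace MFTParams

/-- maximum strength of a rarefaction -/
def rare (P : MFTParams) : ℝ := P.ε ^ P.er
/-- maximum strength of a compression -/
def comp (P : MFTParams) : ℝ := P.ε ^ P.ec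
/-- minimum strength of a compression generated by an interaction -/
def weak (P : MFTParams) : ℝ := P.ε ^ P.ew
/-- strict upper bound for the strength of a passenger -/
def pass (P : MFTParams) : ℝ := P.ε ^ P.ep
/-- minimum explicit jump in the initialization -/
def jump (P : MFTParams) : ℝ := P.ε ^ P.ed
/-- maximum error in the variation in the initialization -/
def init (P : MFTParams) : ℝ := P.ε ^ P.ei

end MFTParams

/-! ## Waves, composite waves, wave sequences -/

/-- The type of a wave. Compressions and rarefactions are the simple waves of negative and
positive strength in a genuinely nonlinear family. -/
inductive WaveKind
  | shock
  | contact
  | simple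

/-- The data of an individual wave which do not concern its motion: strength, family, adjacent
states, type, and preconditioner. -/
structure Wave (N : ℕ) where
  strength : ℝ
  family : Fin N
  left : State N
  right : State N
  kind : WaveKind
  A : State N ≃L[ℝ] State N

/-- A moving jump. It consists of the superposed waves `waves`, listed from left to right, one of
which is the carrier (base wave) and the others are passengers; an ordinary single wave is its own
carrier. All of them move along `x = x0 + speed * (t - t0)`. The composite inherits its virtual
width from the carrier, whose virtual center is `(xc, tc)`. A jump that belongs to a
multi-rarefaction has `pending = some (tSharp, s)`: at time `tSharp` it will revert to the speed
`s` and so to its target trajectory `x = xc + s * (t - tc)`. -/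
structure Front (N : ℕ) where
  waves : List (Wave N)
  carrier : Wave N
  x0 : ℝ
  t0 : ℝ
  speed : ℝ
  xc : ℝ
  tc : ℝ
  pending : Option (ℝ × ℝ)

/-- The listed waves join `a` to `b`: adjacent waves have the intermediate state in common. -/
def Linked {N : ℕ} (a : State N) : List (Wave N) → State N → Prop
  | [], b => a = b
  | γ :: l, b => γ.left = a ∧ Linked γ.right l b

namespace Front

variable {N : ℕ}

/-- Position at time `t`. -/
def pos (F : Front N) (t : ℝ) : ℝ := F.x0 + F.speed * (t - F.t0)

/-- The carrier is a simple `k`-wave. -/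
def IsSimple (F : Front N) (k : Fin N) : Prop := F.carrier.kind = .simple ∧ F.carrier.family = k

/-- Virtual width at time `t`: it changes at the rate `λ_k(u_right) - λ_k(u_left)` and vanishes at
the virtual center. Shocks and contacts have width zero. -/
def width (S : HyperbolicSystem N) (F : Front N) (t : ℝ) : ℝ :=
  match F.carrier.kind with
  | .simple => (S.lam F.carrier.family F.carrier.right - S.lam F.carrier.family F.carrier.left) *
      (t - F.tc)
  | .shock => 0
  | .contact => 0

/-- Left virtual edge. -/
def leftEdge (S : HyperbolicSystem N) (F : Front N) (t : ℝ) : ℝ :=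
  F.xc + S.lam F.carrier.family F.carrier.left * (t - F.tc)

/-- Right virtual edge. -/
def rightEdge (S : HyperbolicSystem N) (F : Front N) (t : ℝ) : ℝ :=
  F.xc + S.lam F.carrier.family F.carrier.right * (t - F.tc)

/-- Multiply the virtual width by `θ` at time `t`, keeping position and speed: the virtual center
slides along the trajectory. -/
def rescale (F : Front N) (t θ : ℝ) : Front N :=
  { F with
    xc := F.pos t - F.speed * (θ * (t - F.tc))
    tc := t - θ * (t - F.tc) }

/-- At the end of a multi-rarefaction the jump gets its target speed. -/
def revert (F : Front N) (t s : ℝ) : Front N :=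
  { F with x0 := F.pos t, t0 := t, speed := s, pending := none }

end Front

/-! ## Wave speeds -/

/-- `s` minimizes the length of the vector residual `∑ A ([f] - s [q])` of the superposed waves. -/
def IsLeastSquaresSpeed {N : ℕ} (S : HyperbolicSystem N) (l : List (Wave N)) (s : ℝ) : Prop :=
  ∀ s' : ℝ,
    ‖(l.map fun γ => γ.A ((S.f γ.right - S.f γ.left) - s • (S.q γ.right - S.q γ.left))).sum‖ ≤
    ‖(l.map fun γ => γ.A ((S.f γ.right - S.f γ.left) - s' • (S.q γ.right - S.q γ.left))).sum‖

/-! ## Resolution of a discretized generalized Riemann problem -/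

/-- A wave which emerges from a point, with the time `tc` of its virtual center. For a piece of a
multi-rarefaction, `multi = some (tSharp, l)`, where `tSharp` is the time at which the
multi-rarefaction ends and `l = λ_k(ū)` is the speed at the middle of the unsplit rarefaction. -/
structure Seed (N : ℕ) where
  wave : Wave N
  tc : ℝ
  multi : Option (ℝ × ℝ)

/-- The type of a single `k`-wave in the solution of a generalized Riemann problem, when the wave
has been assigned the width `w`. -/
def HasKind {N : ℕ} (S : HyperbolicSystem N) (w : ℝ) (γ : Wave N) : Prop :=
  match γ.kind with
  | .contact => S.LinDeg γ.family
  | .simple => S.GNL γ.family ∧ (0 < w ∨ 0 < γ.strength)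
  | .shock => S.GNL γ.family ∧ w = 0 ∧ γ.strength < 0

/-- The waves `l` split a `k`-rarefaction from `uL` to `uR` of strength `ζ` into smaller ones, all
of strength between `κ ε^{e_r}` and `ε^{e_r}`. -/
def IsSplitRarefaction {N : ℕ} (S : HyperbolicSystem N) (P : MFTParams) (k : Fin N)
    (uL : State N) (ζ : ℝ) (uR : State N) (l : List (Wave N)) : Prop :=
  Linked uL l uR ∧ (l.map Wave.strength).sum = ζ ∧
    ∀ γ ∈ l, γ.family = k ∧ γ.kind = .simple ∧ S.SimpleWave k γ.left γ.strength γ.right ∧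
      P.κ * P.rare ≤ γ.strength ∧ γ.strength ≤ P.rare

/-- The waves of family `k`, listed from left to right, which emerge at time `t` when the `k`-wave
from `uL` to `uR` in the solution of the generalized Riemann problem has strength `ζ` and width
`w`. A vanishing wave is dropped; a moderate rarefaction is split, either as a centered rarefaction
if `w = 0`, or as a multi-rarefaction if `w > 0`. -/
def FamilySeeds {N : ℕ} (S : HyperbolicSystem N) (P : MFTParams) (t : ℝ) (k : Fin N) (w : ℝ)
    (uL : State N) (ζ : ℝ) (uR : State N) (l : List (Seed N)) : Prop :=
  -- no wave
  (ζ = 0 ∧ l = []) ∨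
  -- a single wave
  (ζ ≠ 0 ∧ (S.GNL k → ζ ≤ P.rare) ∧ ∃ γ : Wave N,
    γ.strength = ζ ∧ γ.family = k ∧ γ.left = uL ∧ γ.right = uR ∧ HasKind S w γ ∧
    l = [⟨γ, t - w / (S.lam k uR - S.lam k uL), none⟩]) ∨
  -- a centered rarefaction, split
  (S.GNL k ∧ w = 0 ∧ P.rare < ζ ∧ IsSplitRarefaction S P k uL ζ uR (l.map Seed.wave) ∧
    ∀ s ∈ l, s.tc = t ∧ s.multi = none) ∨
  -- a multi-rarefaction
  (S.GNL k ∧ 0 < w ∧ P.rare ≤ ζ ∧ IsSplitRarefaction S P k uL ζ uR (l.map Seed.wave) ∧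
    ∃ m : ℕ, 1 ≤ m ∧ l.length = 2 * m + 1 ∧
      (l.map fun s => s.wave.strength).reverse = l.map (fun s => s.wave.strength) ∧
      ∃ ubar, S.SimpleWave k uL (ζ / 2) ubar ∧ ∃ tSharp, t < tSharp ∧
        w / (S.lam k uR - S.lam k uL) ≤ P.Cmr * (m * P.rare) * (tSharp - t) ∧
        ∀ s ∈ l, s.tc = t - w / (S.lam k uR - S.lam k uL) ∧
          s.multi = some (tSharp, S.lam k ubar))

/-- The waves `l`, listed from left to right, emerge at time `t` from the discretized generalized
Riemann problem with data `uL`, `uR` and widths `w`. All emerging compressions have strength in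
`[-ε^{e_c}, -ε^{e_w}]`: a compression outside this range is replaced by a shock, by resetting
its width to zero before the problem is resolved again. -/
def Resolves {N : ℕ} (S : HyperbolicSystem N) (P : MFTParams) (w : Fin N → ℝ)
    (uL uR : State N) (t : ℝ) (l : List (Seed N)) : Prop :=
  ∃ (ζ : Fin N → ℝ) (u : Fin (N + 1) → State N) (fam : Fin N → List (Seed N)),
    u 0 = uL ∧ u (Fin.last N) = uR ∧ S.Chain w ζ u ∧
    (∀ k, 0 < w k → ζ k < 0 → -P.comp ≤ ζ k ∧ ζ k ≤ -P.weak) ∧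
    (∀ k, FamilySeeds S P t k (w k) (u k.castSucc) (ζ k) (u k.succ) (fam k)) ∧
    l = (List.ofFn fam).flatten

/-! ## Composite waves -/

/-- A carrier with its passengers to the left and to the right. -/
structure Cluster (N : ℕ) where
  pre : List (Seed N)
  carrier : Seed N
  post : List (Seed N)

namespace Cluster

variable {N : ℕ}

/-- All waves of the cluster, from left to right. -/
def seeds (G : Cluster N) : List (Seed N) := G.pre ++ G.carrier :: G.post

/-- The passengers. -/
def passengers (G : Cluster N) : List (Seed N) := G.pre ++ G.post

/-- Least squares speed of the carrier, if all passengers are light; otherwise least squares speed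
of the whole composite wave. -/
def IsSpeed (S : HyperbolicSystem N) (P : MFTParams) (G : Cluster N) (s : ℝ) : Prop :=
  ((∀ p ∈ G.passengers, |p.wave.strength| ≤ P.Q * |G.carrier.wave.strength|) ∧
    IsLeastSquaresSpeed S [G.carrier.wave] s) ∨
  ((∃ p ∈ G.passengers, P.Q * |G.carrier.wave.strength| < |p.wave.strength|) ∧
    IsLeastSquaresSpeed S (G.seeds.map Seed.wave) s)

/-- `F` is the jump which represents the cluster `G` emerging from the point `(x, t)`. A piece of a
multi-rarefaction gets the temporary speed with which it meets its target trajectory at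
`tSharp`. -/
def Launches (S : HyperbolicSystem N) (P : MFTParams) (x t : ℝ) (G : Cluster N) (F : Front N) :
    Prop :=
  F.waves = G.seeds.map Seed.wave ∧ F.carrier = G.carrier.wave ∧ F.x0 = x ∧ F.t0 = t ∧
    F.tc = G.carrier.tc ∧ ∃ s, G.IsSpeed S P s ∧
      match G.carrier.multi with
      | none => F.speed = s ∧ F.xc = x - s * (t - F.tc) ∧ F.pending = none
      | some (tSharp, l) => F.speed = s + (s - l) * (t - F.tc) / (tSharp - t) ∧
          F.xc = x - l * (t - F.tc) ∧ F.pending = some (tSharp, s)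

end Cluster

/-- The emerging waves `l` are organized into carriers with their passengers. A wave of strength at
least `ε^{e_p}` is a carrier. If there are such waves, then every weaker wave is a passenger of the
next one to its left or to its right, of the stronger of the two if there are both. If there are
none, all waves form one lonely weak wave, which is carried by the strongest of them. -/
def IsGrouping {N : ℕ} (P : MFTParams) (l : List (Seed N)) (gs : List (Cluster N)) : Prop :=
  l = gs.flatMap Cluster.seeds ∧
  (((∀ s ∈ l, |s.wave.strength| < P.pass) ∧ gs.length ≤ 1 ∧
      ∀ G ∈ gs, ∀ s ∈ G.seeds, |s.wave.strength| ≤ |G.carrier.wave.strength|) ∨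
    ((∀ G ∈ gs, P.pass ≤ |G.carrier.wave.strength| ∧
        ∀ s ∈ G.passengers, |s.wave.strength| < P.pass) ∧
      gs.IsChain fun G H =>
        (|H.carrier.wave.strength| < |G.carrier.wave.strength| → H.pre = []) ∧
        (|G.carrier.wave.strength| < |H.carrier.wave.strength| → G.post = [])))

/-- The jumps `O` emerge from `(x, t)` when the interaction there has left and right states
`uL`, `uR` and the emerging waves are assigned the virtual widths `w`. -/
def Emerges {N : ℕ} (S : HyperbolicSystem N) (P : MFTParams) (w : Fin N → ℝ)
    (uL uR : State N) (x t : ℝ) (O : List (Front N)) : Prop :=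
  ∃ (l : List (Seed N)) (gs : List (Cluster N)),
    Resolves S P w uL uR t l ∧ IsGrouping P l gs ∧
    List.Forall₂ (Cluster.Launches S P x t) gs O ∧
    O.Pairwise (fun F G => F.speed < G.speed)

/-! ## Interactions -/

/-- Virtual widths which may be assigned to the waves emerging from an interaction of the jumps
`I` at time `t`: they do not exceed the widths of all the incident waves, nor the width of any
incident wave of the same family. -/
def AllowedWidths {N : ℕ} (S : HyperbolicSystem N) (I : List (Front N)) (t : ℝ)
    (w : Fin N → ℝ) : Prop :=
  S.Widths w ∧ ∀ k, (∃ F ∈ I, w k ≤ F.width S t) ∧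
    ∀ F ∈ I, (∃ γ ∈ F.waves, γ.family = k) → w k ≤ F.width S t

/-- Avoidance of overlaps to the right of an interaction at `(x, t)` with emerging jumps `O`. If
the rightmost emerging jump and the next jump to the right are simple waves of the same family and
the left virtual edge of the latter is at or beyond `x`, then the latter is narrowed so that its
edge is to the right of `x`. After this the two do not overlap. (Jumps in the transient phase of
a multi-rarefaction are left alone.) The jumps to the right of the interaction are `B` before
and `B'` after it. -/
def AdjustRight {N : ℕ} (S : HyperbolicSystem N) (x t : ℝ) (O B B' : List (Front N)) : Prop :=
  (B' = B ∨ ∃ (G : Front N) (B₀ : List (Front N)) (θ : ℝ), B = G :: B₀ ∧ G.pending = none ∧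
    (∃ F ∈ O.getLast?, ∃ k, F.IsSimple k ∧ G.IsSimple k) ∧ G.leftEdge S t ≤ x ∧ 0 < θ ∧
    θ * (G.pos t - G.leftEdge S t) < G.pos t - x ∧ B' = G.rescale t θ :: B₀) ∧
  ∀ F ∈ O.getLast?, ∀ G ∈ B'.head?, ∀ k, F.IsSimple k → G.IsSimple k → G.pending = none →
    F.rightEdge S t ≤ G.leftEdge S t

/-- Avoidance of overlaps to the left of an interaction, symmetrically. -/
def AdjustLeft {N : ℕ} (S : HyperbolicSystem N) (x t : ℝ) (O A A' : List (Front N)) : Prop :=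
  (A' = A ∨ ∃ (G : Front N) (A₀ : List (Front N)) (θ : ℝ), A = A₀ ++ [G] ∧ G.pending = none ∧
    (∃ F ∈ O.head?, ∃ k, F.IsSimple k ∧ G.IsSimple k) ∧ x ≤ G.rightEdge S t ∧ 0 < θ ∧
    θ * (G.rightEdge S t - G.pos t) < x - G.pos t ∧ A' = A₀ ++ [G.rescale t θ]) ∧
  ∀ F ∈ O.head?, ∀ G ∈ A'.getLast?, ∀ k, F.IsSimple k → G.IsSimple k → G.pending = none →
    G.rightEdge S t ≤ F.leftEdge S t

/-- What may happen in the wave sequence at time `t`. -/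
inductive Step {N : ℕ} (S : HyperbolicSystem N) (P : MFTParams) (t : ℝ) :
    List (Front N) → List (Front N) → Prop
  /-- the approaching jumps `I`, all those at the point `x`, interact -/
  | interaction (A I B A' O B' : List (Front N)) (x : ℝ) (w : Fin N → ℝ) (uL uR : State N)
      (hA : ∀ F ∈ A, F.pos t < x) (hI : ∀ F ∈ I, F.pos t = x) (hB : ∀ F ∈ B, x < F.pos t)
      (happ : ¬ I.Pairwise (fun F G => F.speed < G.speed))
      (hlink : Linked uL (I.flatMap Front.waves) uR)
      (hw : AllowedWidths S I t w)
      (hO : Emerges S P w uL uR x t O)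
      (hleft : AdjustLeft S x t O A A') (hright : AdjustRight S x t O B B') :
      Step S P t (A ++ I ++ B) (A' ++ O ++ B')
  /-- a compression, the only jump at its position, collapses when its width vanishes; all emerging
  waves have width zero -/
  | collapse (A B A' O B' : List (Front N)) (F : Front N) (uL uR : State N)
      (hA : ∀ G ∈ A, G.pos t < F.pos t) (hB : ∀ G ∈ B, F.pos t < G.pos t)
      (hsimple : F.carrier.kind = .simple) (hcomp : F.carrier.strength < 0)
      (hwidth : F.width S t = 0)
      (hlink : Linked uL F.waves uR)
      (hO : Emerges S P (fun _ => 0) uL uR (F.pos t) t O)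
      (hleft : AdjustLeft S (F.pos t) t O A A') (hright : AdjustRight S (F.pos t) t O B B') :
      Step S P t (A ++ F :: B) (A' ++ O ++ B')
  /-- a piece of a multi-rarefaction reaches its target trajectory and gets its correct speed -/
  | revert (A B : List (Front N)) (F : Front N) (s : ℝ) (hF : F.pending = some (t, s)) :
      Step S P t (A ++ F :: B) (A ++ F.revert t s :: B)

/-- At time `t` nothing is due: the jumps are at distinct positions in the order in which they are
listed, compressions have positive width, and no multi-rarefaction has to end. -/
def Quiet {N : ℕ} (S : HyperbolicSystem N) (Γ : List (Front N)) (t : ℝ) : Prop :=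
  Γ.Pairwise (fun F G => F.pos t < G.pos t) ∧
  ∀ F ∈ Γ, (F.carrier.kind = .simple → F.carrier.strength < 0 → 0 < F.width S t) ∧
    ∀ p ∈ F.pending, t < p.1

/-! ## Initialization -/

/-- The jumps which replace the exact solution of the Riemann problem with data `uL`, `uR` at the
point `(x, 0)`: one for each wave, where strong centered rarefactions have been split. -/
def InitialFan {N : ℕ} (S : HyperbolicSystem N) (P : MFTParams) (uL uR : State N) (x : ℝ)
    (Γ : List (Front N)) : Prop :=
  ∃ l : List (Seed N), Resolves S P (fun _ => 0) uL uR 0 l ∧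
    List.Forall₂ (fun s F => Cluster.Launches S P x 0 ⟨[], s, []⟩ F) l Γ

/-- The jumps which replace the solution of the generalized Riemann problem with data `uL`, `uR`
and widths `w`, placed in the interval `(a, b)`; `w k > 0` for the genuinely nonlinear families.
The simple `k`-wave of width `w k` starts at `y + ∑ i < k, w i`, which gives its center
`(X, τ)`; it is replaced by a single jump with least squares speed through this center, and its
virtual width may be reduced by a factor `θ ≤ 1`. -/
def InitialCell {N : ℕ} (S : HyperbolicSystem N) (P : MFTParams) (uL uR : State N) (a b : ℝ)
    (Γ : List (Front N)) : Prop :=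
  ∃ (w ζ : Fin N → ℝ) (u : Fin (N + 1) → State N) (y : ℝ) (fam : Fin N → List (Front N)),
    S.Widths w ∧ (∀ k, S.GNL k → 0 < w k) ∧ ∑ k, w k < b - a ∧
    a ≤ y ∧ y + ∑ k, w k ≤ b ∧
    u 0 = uL ∧ u (Fin.last N) = uR ∧ S.Chain w ζ u ∧
    (∀ k, S.GNL k → |ζ k| < P.jump) ∧
    (∀ k, (ζ k = 0 ∧ fam k = []) ∨ (ζ k ≠ 0 ∧ ∃ (F : Front N) (X τ θ : ℝ),
      fam k = [F] ∧ F.waves = [F.carrier] ∧ F.carrier.strength = ζ k ∧ F.carrier.family = k ∧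
      F.carrier.left = u k.castSucc ∧ F.carrier.right = u k.succ ∧ HasKind S (w k) F.carrier ∧
      IsLeastSquaresSpeed S [F.carrier] F.speed ∧ F.pending = none ∧
      τ = w k / (S.lam k (u k.castSucc) - S.lam k (u k.succ)) ∧
      X = y + ∑ i ∈ Finset.univ.filter (· < k), w i + S.lam k (u k.castSucc) * τ ∧
      F.t0 = 0 ∧ F.x0 = X - F.speed * τ ∧
      0 < θ ∧ θ ≤ 1 ∧ F.tc = θ * τ ∧ F.xc = F.x0 + F.speed * F.tc)) ∧
    Γ = (List.ofFn fam).flatten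

/-- `Γ` is an initial wave sequence for the data `u0`. There is a grid `x 0 < … < x m` which
contains all jumps of size at least `ε^{e_d}`, outside of which `u0` is constant, and on which the
variation of `u0` is attained up to `ε^{e_i}`; Riemann problems are posed in the grid points and
generalized Riemann problems between them. -/
def IsInitialSequence {N : ℕ} (S : HyperbolicSystem N) (P : MFTParams) (u0 : ℝ → State N)
    (Γ : List (Front N)) : Prop :=
  ∃ (m : ℕ) (x : Fin (m + 1) → ℝ) (fan : Fin (m + 1) → List (Front N))
    (cell : Fin m → List (Front N)),
    StrictMono x ∧
    (∀ y, P.jump ≤ ‖Function.rightLim u0 y - Function.leftLim u0 y‖ → y ∈ range x) ∧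
    (∀ y, y < x 0 → u0 y = Function.leftLim u0 (x 0)) ∧
    (∀ y, x (Fin.last m) < y → u0 y = Function.rightLim u0 (x (Fin.last m))) ∧
    eVariationOn u0 univ < ENNReal.ofReal
      (∑ j, ‖Function.rightLim u0 (x j) - Function.leftLim u0 (x j)‖ +
        ∑ j : Fin m, ‖Function.leftLim u0 (x j.succ) - Function.rightLim u0 (x j.castSucc)‖ +
        P.init) ∧
    (∀ j, InitialFan S P (Function.leftLim u0 (x j)) (Function.rightLim u0 (x j)) (x j) (fan j)) ∧
    (∀ j : Fin m, InitialCell S P (Function.rightLim u0 (x j.castSucc))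
      (Function.leftLim u0 (x j.succ)) (x j.castSucc) (x j.succ) (cell j)) ∧
    Γ = (List.ofFn fun j : Fin m => fan j.castSucc ++ cell j).flatten ++ fan (Fin.last m)

/-! ## The approximation -/

/-- The Heaviside function with `H(0) = 1/2`. -/
def heaviside (x : ℝ) : ℝ := if x < 0 then 0 else if x = 0 then 1 / 2 else 1

/-- A modified front tracking (mFT) approximation: initial data of bounded variation, the
interaction times `0 = time 0 < time 1 ≤ time 2 ≤ …`, and for each `i` the wave sequence
`stage i` between `time i` and `time (i + 1)`. If there is no further interaction after `time i`,
then `time (i + 1) = ∞`; what follows is then immaterial. -/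
structure MFTApproximation {N : ℕ} (S : HyperbolicSystem N) (P : MFTParams) where
  /-- initial data -/
  u0 : ℝ → State N
  boundedVariation : BoundedVariationOn u0 univ
  average : ∀ x, u0 x = (1 / 2 : ℝ) • (Function.leftLim u0 x + Function.rightLim u0 x)
  limits_mem : ∀ x, Function.leftLim u0 x ∈ S.states ∧ Function.rightLim u0 x ∈ S.states
  /-- the state to the left of all waves -/
  base : State N
  eventually_base : ∀ᶠ x in atBot, u0 x = base
  /-- interaction times -/
  time : ℕ → ℝ≥0∞
  /-- wave sequences -/
  stage : ℕ → List (Front N)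
  time_zero : time 0 = 0
  time_one_pos : 0 < time 1
  time_mono : Monotone time
  initial : IsInitialSequence S P u0 (stage 0)
  preconditioner : ∀ i, time i < ∞ → ∀ F ∈ stage i, ∀ γ ∈ F.waves,
    ‖(γ.A : State N →L[ℝ] State N)‖ ≤ P.KA ∧ ‖(γ.A.symm : State N →L[ℝ] State N)‖ ≤ P.KA
  quiet : ∀ i, ∀ t : ℝ, time i < ENNReal.ofReal t → ENNReal.ofReal t < time (i + 1) →
    Quiet S (stage i) t
  step : ∀ i, time (i + 1) < ∞ → Step S P (time (i + 1)).toReal (stage i) (stage (i + 1))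

namespace MFTApproximation

variable {N : ℕ} {S : HyperbolicSystem N} {P : MFTParams}

/-- `t_∞`, the supremum of the interaction times. -/
def timeInfty (M : MFTApproximation S P) : ℝ≥0∞ := ⨆ i, M.time i

/-- The index of the wave sequence at time `t`, for `0 ≤ t < t_∞`. -/
def index (M : MFTApproximation S P) (t : ℝ) : ℕ :=
  sInf {i : ℕ | ENNReal.ofReal t < M.time (i + 1)}

/-- The piecewise constant approximation
`U^ε(x, t) = u_0 + ∑ [u]_j H(x - x^p_j(t))`, for `0 ≤ t < t_∞`. -/
def U (M : MFTApproximation S P) (x t : ℝ) : State N :=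
  M.base + ((M.stage (M.index t)).map fun F =>
    heaviside (x - F.pos t) • (F.waves.map fun γ => γ.right - γ.left).sum).sum

end MFTApproximation

/-- The `α`-ray condition at `(x, T)` for a function `U(x, t)`, `t < T`, with state space `Ω`:
the limit of `U` along the ray of speed `α` into `(x, T)` exists, uniformly for `α` in compact
intervals. The limit exists in the open set `Ω`: for (almost all) `α` in a compact interval it is
in a compact subset of `Ω`. (On the rays that carry a jump, `U` is the average of the two
adjacent states.) -/
def AlphaRayCondition {N : ℕ} (Ω : Set (State N)) (U : ℝ → ℝ → State N) (x T : ℝ) : Prop :=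
  ∃ V : ℝ → State N, ∀ a b : ℝ,
    TendstoUniformlyOn (fun t α => U (x + α * (t - T)) t) V (𝓝[<] T) (Icc a b) ∧
    ∃ K : Set (State N), IsCompact K ∧ K ⊆ Ω ∧ ∀ᵐ α, α ∈ Icc a b → V α ∈ K

end

/-! Suppose that the ray condition holds at every point at the time `T = t_∞`. The sum of the jump
sizes can only grow when an interaction sends out several fronts: if at most one emerges, its size
is at most the sum of the incident sizes, by the triangle inequality. So it suffices that from some
time before `T` on every interaction produces at most one front
(`JumpTracking.exists_totalSize_le`). All jumps stay in a compact interval, so this is a local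
question, which `JumpTracking.exists_nhds_single` answers.

The hyperbolic system enters only through `EmissionLaw`, established in `emissionLaw_frontLaw`.
Generalized Riemann problems with close data in a compact set of states have only weak waves: an
open mapping argument gives a weak solution, and by global uniqueness there is no other
(`HyperbolicSystem.exists_forall_chain_lt`). Hence an interaction between close states emits only
waves below `ε^{e_p}`, and these are bundled into one front. If several fronts emerge, each has a
carrier of strength at least `ε^{e_p}`. A carrier and its passengers belong to different families,
so they solve a generalized Riemann problem of their own, whose outer states cannot be close: each
of the fronts is large.

Near `(x, T)`, let `U` be `δ`-close to its limit `V` along rays. A jump larger than `4δ` must run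
along a ray into `(x, T)`. Otherwise it sweeps a whole interval of rays, across each of which `V`
then varies too much for `U` to be locally constant there at a fixed other time; but at that time
there are only finitely many jumps (`pos_eq_of_lt_norm_height`). Several large fronts that leave one
point with different speeds cannot all aim at `(x, T)`, so emissions in the cone of rays produce at
most one front (`single_of_between`).

It follows that the number of jumps in a cone at least as wide as the speed bound stays bounded.
Jumps between rays faster than this bound have size at most `4δ`, with `δ` arbitrary and their
number fixed, so `V` is constant on such rays (`limit_eq`). A point near `x` outside the cone lies
in the domain of dependence of an interval that meets only such rays. There the states are nearly
equal, and this persists because emissions between close states produce at most one front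
(`single_of_close`). -/

/-! ## Abstract jump tracking -/

/-- A jump discontinuity that moves on a straight line: its position at time `0`, its speed, the
state to its left, the difference of the states to its right and left, and the time at which its
speed is due to change. -/
@[ext] structure Jump (N : ℕ) where
  start : ℝ
  speed : ℝ
  left : State N
  height : State N
  due : Option ℝ

namespace Jump

variable {N : ℕ}

/-- Position at time `t`. -/
def pos (F : Jump N) (t : ℝ) : ℝ := F.start + F.speed * t

/-- The state to the right of the jump. -/
def right (F : Jump N) : State N := F.left + F.height

theorem pos_add (F : Jump N) (s t : ℝ) : F.pos t = F.pos s + F.speed * (t - s) := by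
  simp only [pos]; ring

theorem continuous_pos (F : Jump N) : Continuous F.pos := by
  unfold pos; fun_prop

end Jump

/-- The difference of the outer states of a list of jumps. -/
noncomputable def totalHeight {N : ℕ} (l : List (Jump N)) : State N := (l.map Jump.height).sum

/-- The jumps, listed from left to right, start from the state `a`, and the right state of each is
the left state of the next. -/
def Adjoined {N : ℕ} : State N → List (Jump N) → Prop
  | _, [] => True
  | a, F :: l => F.left = a ∧ Adjoined F.right l

section lists

variable {N : ℕ}

@[simp] theorem totalHeight_nil : totalHeight ([] : List (Jump N)) = 0 := rfl

@[simp] theorem totalHeight_cons (F : Jump N) (l : List (Jump N)) :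
    totalHeight (F :: l) = F.height + totalHeight l := by simp [totalHeight]

@[simp] theorem totalHeight_append (l l' : List (Jump N)) :
    totalHeight (l ++ l') = totalHeight l + totalHeight l' := by simp [totalHeight]

theorem adjoined_append {a : State N} {l l' : List (Jump N)} :
    Adjoined a (l ++ l') ↔ Adjoined a l ∧ Adjoined (a + totalHeight l) l' := by
  induction l generalizing a with
  | nil => simp [Adjoined]
  | cons F l ih =>
    simp only [List.cons_append, Adjoined, ih, totalHeight_cons, and_assoc, Jump.right]
    refine and_congr_right fun h => ?_
    rw [h, add_assoc]

theorem Adjoined.left_eq {a : State N} {A B : List (Jump N)} {F : Jump N}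
    (h : Adjoined a (A ++ F :: B)) : F.left = a + totalHeight A :=
  (adjoined_append.1 h).2.1

/-- A piecewise constant function with the given jumps. -/
noncomputable def stepValue (a : State N) (l : List (Jump N)) (x t : ℝ) : State N :=
  a + (l.map fun F => heaviside (x - F.pos t) • F.height).sum

theorem heaviside_of_neg {x : ℝ} (h : x < 0) : heaviside x = 0 := by simp [heaviside, h]

theorem heaviside_of_pos {x : ℝ} (h : 0 < x) : heaviside x = 1 := by
  simp [heaviside, h.not_gt, h.ne']

theorem heaviside_mono : Monotone heaviside := by
  intro x y h
  unfold heaviside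
  split_ifs <;> grind

theorem heaviside_mem (x : ℝ) : 0 ≤ heaviside x ∧ heaviside x ≤ 1 := by
  unfold heaviside
  split_ifs <;> norm_num

theorem sum_heaviside_of_lt {l : List (Jump N)} {x t : ℝ} (h : ∀ F ∈ l, F.pos t < x) :
    (l.map fun F => heaviside (x - F.pos t) • F.height).sum = totalHeight l := by
  unfold totalHeight
  congr 1
  refine List.map_congr_left fun F hF => ?_
  rw [heaviside_of_pos (sub_pos.2 (h F hF)), one_smul]

theorem sum_heaviside_of_gt {l : List (Jump N)} {x t : ℝ} (h : ∀ F ∈ l, x < F.pos t) :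
    (l.map fun F => heaviside (x - F.pos t) • F.height).sum = 0 := by
  refine List.sum_eq_zero fun y hy => ?_
  obtain ⟨F, hF, rfl⟩ := List.mem_map.1 hy
  rw [heaviside_of_neg (sub_neg.2 (h F hF)), zero_smul]

theorem eventually_forall_mem {ι α : Type*} {f : Filter α} {l : List ι} {p : ι → α → Prop}
    (h : ∀ i ∈ l, ∀ᶠ x in f, p i x) : ∀ᶠ x in f, ∀ i ∈ l, p i x :=
  (Set.Finite.eventually_all (l := f) (List.finite_toSet l)).2 h

/-- Strict sorting keeps the other jumps away from `F`, so just to its left the jumps listed before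
it count fully and the others not at all. -/
theorem stepValue_eventually_left {a : State N} {l A B : List (Jump N)} {F : Jump N} {t : ℝ}
    (hl : l = A ++ F :: B) (ha : Adjoined a l) (hs : l.Pairwise (fun F G => F.pos t < G.pos t)) :
    ∀ᶠ x in 𝓝[<] (F.pos t), stepValue a l x t = F.left := by
  subst hl
  rw [List.pairwise_append] at hs
  obtain ⟨-, hB, hA⟩ := hs
  have h1 : ∀ᶠ x in 𝓝[<] (F.pos t), ∀ G ∈ A, G.pos t < x :=
    eventually_forall_mem fun G hG =>
      (eventually_gt_nhds (hA G hG F (by simp))).filter_mono nhdsWithin_le_nhds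
  filter_upwards [h1, self_mem_nhdsWithin] with x hx hx'
  have hx' : x < F.pos t := hx'
  rw [stepValue, List.map_append, List.sum_append, sum_heaviside_of_lt hx, sum_heaviside_of_gt,
    add_zero, ha.left_eq]
  intro G hG
  rcases List.mem_cons.1 hG with rfl | hG
  · exact hx'
  · exact hx'.trans ((List.pairwise_cons.1 hB).1 G hG)

theorem stepValue_eventually_right {a : State N} {l A B : List (Jump N)} {F : Jump N} {t : ℝ}
    (hl : l = A ++ F :: B) (ha : Adjoined a l) (hs : l.Pairwise (fun F G => F.pos t < G.pos t)) :
    ∀ᶠ x in 𝓝[>] (F.pos t), stepValue a l x t = F.right := by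
  subst hl
  rw [List.pairwise_append] at hs
  obtain ⟨-, hB, hA⟩ := hs
  have h1 : ∀ᶠ x in 𝓝[>] (F.pos t), ∀ G ∈ B, x < G.pos t :=
    eventually_forall_mem fun G hG =>
      (eventually_lt_nhds ((List.pairwise_cons.1 hB).1 G hG)).filter_mono nhdsWithin_le_nhds
  filter_upwards [h1, self_mem_nhdsWithin] with x hx hx'
  have hx' : F.pos t < x := hx'
  have : A ++ F :: B = (A ++ [F]) ++ B := by simp
  rw [Jump.right, ha.left_eq, this, stepValue, List.map_append, List.sum_append,
    sum_heaviside_of_lt, sum_heaviside_of_gt hx, add_zero]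
  · simp [add_assoc]
  intro G hG
  rcases List.mem_append.1 hG with hG | hG
  · exact (hA G hG F (by simp)).trans hx'
  · rw [List.mem_singleton.1 hG]; exact hx'

theorem stepValue_eventually_const {a : State N} {l : List (Jump N)} {x t : ℝ}
    (h : ∀ F ∈ l, F.pos t ≠ x) : ∀ᶠ y in 𝓝 x, stepValue a l y t = stepValue a l x t := by
  have : ∀ᶠ y in 𝓝 x, ∀ F ∈ l, heaviside (y - F.pos t) = heaviside (x - F.pos t) := by
    refine eventually_forall_mem fun F hF => ?_
    rcases (h F hF).lt_or_gt with h | h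
    · filter_upwards [eventually_gt_nhds h] with y hy
      rw [heaviside_of_pos (sub_pos.2 hy), heaviside_of_pos (sub_pos.2 h)]
    · filter_upwards [eventually_lt_nhds h] with y hy
      rw [heaviside_of_neg (sub_neg.2 hy), heaviside_of_neg (sub_neg.2 h)]
  filter_upwards [this] with y hy
  unfold stepValue
  congr 2
  exact List.map_congr_left fun F hF => by rw [hy F hF]

theorem norm_list_sum_le {ι : Type*} (l : List ι) (f : ι → State N) :
    ‖(l.map f).sum‖ ≤ (l.map fun i => ‖f i‖).sum := by
  induction l with
  | nil => simp
  | cons i l ih => simpa using (norm_add_le _ _).trans (by gcongr)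

theorem stepValue_sub (a : State N) (l : List (Jump N)) (x y t : ℝ) :
    stepValue a l y t - stepValue a l x t =
      (l.map fun F => (heaviside (y - F.pos t) - heaviside (x - F.pos t)) • F.height).sum := by
  unfold stepValue
  induction l with
  | nil => simp
  | cons F l ih =>
    simp only [List.map_cons, List.sum_cons] at ih ⊢
    rw [← ih, sub_smul]; abel

/-- The sum of the sizes of the jumps. -/
noncomputable def totalSize (l : List (Jump N)) : ℝ := (l.map fun F => ‖F.height‖).sum

theorem norm_totalHeight_le (l : List (Jump N)) : ‖totalHeight l‖ ≤ totalSize l := by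
  exact norm_list_sum_le l Jump.height

theorem totalSize_nonneg (l : List (Jump N)) : 0 ≤ totalSize l :=
  List.sum_nonneg fun y hy => by
    obtain ⟨F, -, rfl⟩ := List.mem_map.1 hy
    exact norm_nonneg _

/-- Along a partition, the contribution of each jump telescopes, since the Heaviside function is
monotone with values in `[0, 1]`. No sorting is needed. -/
theorem eVariationOn_stepValue_le (a : State N) (l : List (Jump N)) (t : ℝ) :
    eVariationOn (fun x => stepValue a l x t) univ ≤ ENNReal.ofReal (totalSize l) := by
  refine iSup_le fun p => ?_
  obtain ⟨n, u, hu, -⟩ := p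
  have key : ∀ i, edist (stepValue a l (u (i + 1)) t) (stepValue a l (u i) t) ≤
      ENNReal.ofReal ((l.map fun F =>
        (heaviside (u (i + 1) - F.pos t) - heaviside (u i - F.pos t)) * ‖F.height‖).sum) := by
    intro i
    rw [edist_dist, dist_eq_norm, stepValue_sub]
    refine ENNReal.ofReal_le_ofReal ((norm_list_sum_le _ _).trans (le_of_eq ?_))
    congr 1
    refine List.map_congr_left fun F _ => ?_
    rw [norm_smul, Real.norm_of_nonneg]
    exact sub_nonneg.2 (heaviside_mono (by linarith [hu (Nat.le_succ i)]))
  refine (Finset.sum_le_sum fun i _ => key i).trans ?_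
  rw [← ENNReal.ofReal_sum_of_nonneg]
  · refine ENNReal.ofReal_le_ofReal ?_
    have : ∀ l : List (Jump N), ∑ i ∈ Finset.range n, (l.map fun F =>
        (heaviside (u (i + 1) - F.pos t) - heaviside (u i - F.pos t)) * ‖F.height‖).sum =
        (l.map fun F => (heaviside (u n - F.pos t) - heaviside (u 0 - F.pos t)) *
          ‖F.height‖).sum := by
      intro l
      induction l with
      | nil => simp
      | cons F l ih =>
        simp only [List.map_cons, List.sum_cons, Finset.sum_add_distrib, ih]
        rw [← Finset.sum_mul, Finset.sum_range_sub (fun i => heaviside (u i - F.pos t))]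
    rw [this]
    refine List.sum_le_sum fun F _ => ?_
    have h1 := heaviside_mem (u n - F.pos t)
    have h2 := heaviside_mem (u 0 - F.pos t)
    exact mul_le_of_le_one_left (norm_nonneg _) (by linarith)
  · intro i _
    refine List.sum_nonneg fun y hy => ?_
    obtain ⟨F, -, rfl⟩ := List.mem_map.1 hy
    refine mul_nonneg (sub_nonneg.2 (heaviside_mono ?_)) (norm_nonneg _)
    linarith [hu (Nat.le_succ i)]

end lists

/-! ### Emissions, changes of speed, and the histories made of them -/

/-- At time `t`, the jumps `I` at `x`, between the jumps `A` and `B`, are replaced by the jumps `O`,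
which emerge from `x`. The relation `law a O` says which jumps may emerge to the right of the
state `a`. -/
structure IsEmission {N : ℕ} (law : State N → List (Jump N) → Prop) (t x : ℝ) (a : State N)
    (A I B O : List (Jump N)) : Prop where
  left : ∀ F ∈ A, F.pos t < x
  incident : ∀ F ∈ I, F.pos t = x
  right : ∀ F ∈ B, x < F.pos t
  nonempty : I ≠ []
  approaching : I.Pairwise (fun F G => F.speed < G.speed) → I.length ≤ 1
  emerging : ∀ F ∈ O, F.pos t = x ∧ ∀ s ∈ F.due, t < s
  increasing : O.Pairwise (fun F G => F.speed < G.speed)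
  adjoined_in : Adjoined a I
  adjoined_out : Adjoined a O
  total : totalHeight O = totalHeight I
  obeys : law a O

/-- The events in a list of jumps at time `t`: an emission, or a single jump changes its speed. -/
inductive JumpStep {N : ℕ} (law : State N → List (Jump N) → Prop) (t : ℝ) :
    List (Jump N) → List (Jump N) → Prop
  | emission {x : ℝ} {a : State N} {A I B O : List (Jump N)} (h : IsEmission law t x a A I B O) :
      JumpStep law t (A ++ I ++ B) (A ++ O ++ B)
  | redirect {A B : List (Jump N)} {F G : Jump N} (due : F.due = some t) (pos : G.pos t = F.pos t)
      (left : G.left = F.left) (height : G.height = F.height) :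
      JumpStep law t (A ++ F :: B) (A ++ G :: B)

/-- A piecewise constant function of `x ∈ ℝ` and `t < T` whose jumps move on straight lines, with
speeds at most `Λ`, between the times `time i`, at which one of the events `JumpStep` happens. -/
structure JumpTracking (N : ℕ) (law : State N → List (Jump N) → Prop) (T Λ : ℝ) where
  base : State N
  time : ℕ → ℝ
  stage : ℕ → List (Jump N)
  time_zero : time 0 = 0
  time_one_pos : 0 < time 1
  monotone_time : Monotone time
  time_le : ∀ i, time i ≤ T
  exists_lt_time : ∀ t < T, ∃ i, t < time i
  adjoined_zero : Adjoined base (stage 0)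
  sorted : ∀ i t, time i < t → t < time (i + 1) →
    (stage i).Pairwise (fun F G => F.pos t < G.pos t)
  step : ∀ i, JumpStep law (time (i + 1)) (stage i) (stage (i + 1))
  speed_le : ∀ i, ∀ F ∈ stage i, |F.speed| ≤ Λ

/-! ### What survives an event -/

section steps

variable {N : ℕ} {law : State N → List (Jump N) → Prop}

theorem IsEmission.left_mem {t x : ℝ} {a : State N} {A I B O : List (Jump N)}
    (h : IsEmission law t x a A I B O) : ∃ F ∈ I, F.left = a := by
  obtain ⟨F, l, rfl⟩ := List.exists_cons_of_ne_nil h.nonempty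
  exact ⟨F, by simp, h.adjoined_in.1⟩

theorem exists_right_eq {a : State N} {l : List (Jump N)} (h : Adjoined a l) (hl : l ≠ []) :
    ∃ F ∈ l, F.right = a + totalHeight l := by
  obtain ⟨l', F, rfl⟩ : ∃ l' F, l = l' ++ [F] :=
    ⟨_, _, (List.dropLast_append_getLast hl).symm⟩
  refine ⟨F, by simp, ?_⟩
  rw [Jump.right, h.left_eq]; simp [add_assoc]

/-- An emission replaces a block of jumps by one with the same left state and the same total height,
so the states further right do not notice it. -/
theorem JumpStep.adjoined {t : ℝ} {a : State N} {l l' : List (Jump N)} (h : JumpStep law t l l')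
    (hl : Adjoined a l) : Adjoined a l' := by
  cases h with
  | @emission x b A I B O h =>
    rw [adjoined_append, adjoined_append] at hl ⊢
    obtain ⟨F, l, rfl⟩ := List.exists_cons_of_ne_nil h.nonempty
    have : b = a + totalHeight A := h.adjoined_in.1.symm.trans hl.1.2.1
    subst this
    refine ⟨⟨hl.1.1, h.adjoined_out⟩, ?_⟩
    have := hl.2
    rwa [totalHeight_append, ← h.total, ← totalHeight_append] at this
  | redirect _ _ hleft hheight =>
    rw [adjoined_append] at hl ⊢
    refine ⟨hl.1, ?_⟩
    have := hl.2
    simp only [Adjoined, Jump.right] at this ⊢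
    rwa [hleft, hheight]

/-- At time `t` at least two jumps with the property `Q` depart from `x`, with increasing speeds. -/
def Fan (Q : Jump N → Prop) (x t : ℝ) (l : List (Jump N)) : Prop :=
  ∃ O : List (Jump N), l.filter (fun F => F.pos t = x) = O ∧ 2 ≤ O.length ∧
    O.Pairwise (fun F G => F.speed < G.speed) ∧ ∀ F ∈ O, Q F ∧ ∀ s ∈ F.due, t < s

theorem filter_pos_eq {t x : ℝ} {A I B : List (Jump N)} (hA : ∀ F ∈ A, F.pos t < x)
    (hI : ∀ F ∈ I, F.pos t = x) (hB : ∀ F ∈ B, x < F.pos t) :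
    (A ++ I ++ B).filter (fun F => F.pos t = x) = I := by
  have h1 : A.filter (fun F => F.pos t = x) = [] :=
    List.filter_eq_nil_iff.2 fun F hF => by simpa using (hA F hF).ne
  have h2 : B.filter (fun F => F.pos t = x) = [] :=
    List.filter_eq_nil_iff.2 fun F hF => by simpa using (hB F hF).ne'
  have h3 : I.filter (fun F => F.pos t = x) = I :=
    List.filter_eq_self.2 fun F hF => by simpa using hI F hF
  simp [List.filter_append, h1, h2, h3]

theorem IsEmission.filter_in {t x : ℝ} {a : State N} {A I B O : List (Jump N)}
    (h : IsEmission law t x a A I B O) : (A ++ I ++ B).filter (fun F => F.pos t = x) = I :=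
  filter_pos_eq h.left h.incident h.right

theorem IsEmission.filter_out {t x : ℝ} {a : State N} {A I B O : List (Jump N)}
    (h : IsEmission law t x a A I B O) : (A ++ O ++ B).filter (fun F => F.pos t = x) = O :=
  filter_pos_eq h.left (fun F hF => (h.emerging F hF).1) h.right

/-- Several events may share a time. A fan cannot interact again at the time of its creation,
because its jumps diverge, and none of them can be redirected, because their due times are later. So
it is still there when time moves on. -/
theorem JumpStep.fan {Q : Jump N → Prop} {x t : ℝ} {l l' : List (Jump N)}
    (h : JumpStep law t l l') (hl : Fan Q x t l) : Fan Q x t l' := by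
  obtain ⟨O', hO', hlen, hinc, hQ⟩ := hl
  cases h with
  | @emission y b A I B O h =>
    refine ⟨O', ?_, hlen, hinc, hQ⟩
    rcases eq_or_ne y x with rfl | hne
    · rw [h.filter_in] at hO'
      subst hO'
      exact absurd (h.approaching hinc) (by omega)
    · rw [← hO', List.filter_append, List.filter_append, List.filter_append, List.filter_append]
      congr 2
      rw [List.filter_eq_nil_iff.2, List.filter_eq_nil_iff.2]
      · intro F hF; simpa [h.incident F hF] using hne
      · intro F hF; simpa [(h.emerging F hF).1] using hne
  | @redirect A B F G due pos _ _ =>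
    refine ⟨O', ?_, hlen, hinc, hQ⟩
    by_cases hF : F.pos t = x
    · have : F ∈ O' := by rw [← hO']; simp [hF]
      exact absurd ((hQ F this).2 t due) (lt_irrefl _)
    · rw [← hO']
      simp [List.filter_append, hF, pos]

theorem JumpStep.exists_pos_eq {t : ℝ} {l l' : List (Jump N)} (h : JumpStep law t l l') :
    ∀ G ∈ l', ∃ F ∈ l, F.pos t = G.pos t := by
  cases h with
  | @emission y b A I B O h =>
    intro G hG
    obtain ⟨F, hF, -⟩ := h.left_mem
    rcases List.mem_append.1 hG with hG | hG
    · rcases List.mem_append.1 hG with hG | hG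
      · exact ⟨G, by simp [hG], rfl⟩
      · exact ⟨F, by simp [hF], by rw [h.incident F hF, (h.emerging G hG).1]⟩
    · exact ⟨G, by simp [hG], rfl⟩
  | @redirect A B F G' _ hpos _ _ =>
    intro G hG
    rcases List.mem_append.1 hG with hG | hG
    · exact ⟨G, by simp [hG], rfl⟩
    · rcases List.mem_cons.1 hG with rfl | hG
      · exact ⟨F, by simp, hpos.symm⟩
      · exact ⟨G, by simp [hG], rfl⟩

end steps

/-! ### Propagation in time and finite speed -/

namespace JumpTracking

variable {N : ℕ} {law : State N → List (Jump N) → Prop} {T Λ : ℝ} (J : JumpTracking N law T Λ)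

theorem adjoined (i : ℕ) : Adjoined J.base (J.stage i) := by
  induction i with
  | zero => exact J.adjoined_zero
  | succ i ih => exact (J.step i).adjoined ih

theorem time_nonneg (i : ℕ) : 0 ≤ J.time i := by
  rw [← J.time_zero]; exact J.monotone_time (Nat.zero_le i)

/-- When several events share a time, this selects the stage after the last of them, the one that
lasts for a positive time. -/
theorem exists_stage {t : ℝ} (h0 : 0 ≤ t) (hT : t < T) :
    ∃ i, J.time i ≤ t ∧ t < J.time (i + 1) := by
  classical
  have h := J.exists_lt_time t hT
  have h1 : Nat.find h ≠ 0 := fun h2 => by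
    have := Nat.find_spec h
    rw [h2, J.time_zero] at this
    linarith
  obtain ⟨i, hi⟩ := Nat.exists_eq_succ_of_ne_zero h1
  exact ⟨i, not_lt.1 (Nat.find_min h (by omega)), by simpa [hi] using Nat.find_spec h⟩

theorem le_of_time {i j : ℕ} {s t : ℝ} (hi : J.time i ≤ s) (hst : s ≤ t)
    (hj : t < J.time (j + 1)) : i ≤ j := by
  by_contra h
  exact absurd (J.monotone_time (show j + 1 ≤ i by omega)) (by linarith)

/-- A property that holds at time `t₀` holds afterwards, if it is preserved by free motion and by
the events. -/
theorem propagate {P : ℝ → List (Jump N) → Prop} {i₀ : ℕ} {t₀ : ℝ}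
    (h0' : t₀ < J.time (i₀ + 1)) (hP : P t₀ (J.stage i₀))
    (flight : ∀ i s s', t₀ ≤ s → s ≤ s' → s' < T → P s (J.stage i) → P s' (J.stage i))
    (step : ∀ i, t₀ < J.time (i + 1) → J.time (i + 1) < T → P (J.time (i + 1)) (J.stage i) →
      P (J.time (i + 1)) (J.stage (i + 1))) {i : ℕ} (hi : i₀ ≤ i) {t : ℝ} (ht0 : t₀ ≤ t)
    (hit : J.time i ≤ t) (htT : t < T) : P t (J.stage i) := by
  -- The time `t` may lie beyond the end of stage `i`, whose jumps are then continued on their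
  -- lines. This makes the induction hypothesis available for stage `i` at the very time of the
  -- event that ends it.
  induction i, hi using Nat.le_induction generalizing t with
  | base => exact flight i₀ t₀ t le_rfl ht0 htT hP
  | succ i hi ih =>
    have h1 : t₀ < J.time (i + 1) := h0'.trans_le (J.monotone_time (by omega))
    have h2 : J.time (i + 1) < T := hit.trans_lt htT
    exact flight _ _ _ h1.le hit htT
      (step i h1 h2 (ih h1.le (J.monotone_time (Nat.le_succ i)) h2))

theorem pos_sub_le {i : ℕ} {F : Jump N} (hF : F ∈ J.stage i) {s t : ℝ} (hst : s ≤ t) :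
    |F.pos t - F.pos s| ≤ Λ * (t - s) := by
  rw [F.pos_add s t, add_sub_cancel_left, abs_mul, abs_of_nonneg (sub_nonneg.2 hst)]
  exact mul_le_mul_of_nonneg_right (J.speed_le i F hF) (sub_nonneg.2 hst)

/-- All jumps stay in a compact interval. -/
theorem exists_forall_abs_pos_le (hΛ : 0 ≤ Λ) :
    ∃ R, ∀ i t, J.time i ≤ t → t < T → ∀ F ∈ J.stage i, |F.pos t| ≤ R := by
  rcases le_or_gt T 0 with hT | hT
  · refine ⟨0, fun i t hi ht => ?_⟩
    linarith [J.time_nonneg i]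
  obtain ⟨R, hR⟩ : ∃ R, ∀ F ∈ J.stage 0, |F.pos 0| ≤ R := by
    obtain ⟨R, hR⟩ := ((List.finite_toSet (J.stage 0)).image fun F => |F.pos 0|).bddAbove
    exact ⟨R, fun F hF => hR ⟨F, hF, rfl⟩⟩
  have key : ∀ i t, J.time i ≤ t → t < T → ∀ F ∈ J.stage i, |F.pos t| ≤ R + Λ * t := by
    intro i t hi ht
    refine J.propagate (P := fun t l => ∀ F ∈ l, |F.pos t| ≤ R + Λ * t)
      J.time_one_pos (by simpa using hR) ?_ ?_ (Nat.zero_le i) ((J.time_nonneg i).trans hi) hi ht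
    · intro i s s' _ hs _ h F hF
      have h1 := h F hF
      have h2 := J.pos_sub_le hF hs
      have h3 := abs_sub_abs_le_abs_sub (F.pos s') (F.pos s)
      linarith
    · intro i _ _ h G hG
      obtain ⟨F, hF, hFG⟩ := (J.step i).exists_pos_eq G hG
      exact hFG ▸ h F hF
  refine ⟨R + Λ * T, fun i t hi ht F hF => (key i t hi ht F hF).trans ?_⟩
  gcongr

end JumpTracking

/-! ### Rays into a point at the final time -/

/-- The position at time `t` on the ray into `(x, T)` with slope `β` (and so with speed `-β`). -/
def ray (x T β t : ℝ) : ℝ := x + β * (T - t)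

theorem ray_lt_ray {x T β β' t : ℝ} (ht : t < T) : ray x T β t < ray x T β' t ↔ β < β' := by
  unfold ray
  rw [add_lt_add_iff_left, mul_lt_mul_iff_left₀ (sub_pos.2 ht)]

theorem ray_le_ray {x T β β' t : ℝ} (ht : t < T) : ray x T β t ≤ ray x T β' t ↔ β ≤ β' := by
  unfold ray
  rw [add_le_add_iff_left, mul_le_mul_iff_left₀ (sub_pos.2 ht)]

theorem exists_ray_eq (x T y : ℝ) {t : ℝ} (ht : t < T) : ∃ β, ray x T β t = y :=
  ⟨(y - x) / (T - t), by unfold ray; rw [div_mul_cancel₀ _ (sub_pos.2 ht).ne']; ring⟩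

theorem continuous_ray (x T t : ℝ) : Continuous fun β => ray x T β t := by
  unfold ray; fun_prop

theorem continuous_ray_time (x T β : ℝ) : Continuous (ray x T β) := by
  unfold ray; fun_prop

theorem tendsto_ray_left (x T β : ℝ) {t : ℝ} (ht : t < T) :
    Tendsto (fun β => ray x T β t) (𝓝[<] β) (𝓝[<] (ray x T β t)) := by
  refine tendsto_nhdsWithin_of_tendsto_nhds_of_eventually_within _
    ((continuous_ray x T t).continuousAt.tendsto.mono_left nhdsWithin_le_nhds) ?_
  filter_upwards [self_mem_nhdsWithin] with β' hβ'
  exact (ray_lt_ray ht).2 hβ'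

theorem tendsto_ray_right (x T β : ℝ) {t : ℝ} (ht : t < T) :
    Tendsto (fun β => ray x T β t) (𝓝[>] β) (𝓝[>] (ray x T β t)) := by
  refine tendsto_nhdsWithin_of_tendsto_nhds_of_eventually_within _
    ((continuous_ray x T t).continuousAt.tendsto.mono_left nhdsWithin_le_nhds) ?_
  filter_upwards [self_mem_nhdsWithin] with β' hβ'
  exact (ray_lt_ray ht).2 hβ'

/-- The values of `U` on the rays with slopes in `[-A, A]` into `(x, T)` are `δ`-close to `V` from
the time `t₀` on. -/
def RayClose {N : ℕ} (U : ℝ → ℝ → State N) (x T A : ℝ) (V : ℝ → State N) (δ t₀ : ℝ) : Prop :=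
  ∀ t ∈ Ico t₀ T, ∀ β ∈ Icc (-A) A, ‖U (ray x T β t) t - V β‖ ≤ δ

/-- The limit along rays is known to lie in a compact set only for almost every slope. A set of full
measure is dense, so a good slope exists arbitrarily close on a prescribed side. -/
theorem exists_ae_of_eventually_left {p q : ℝ → Prop} (hp : ∀ᵐ β, p β) {β : ℝ}
    (hq : ∀ᶠ β' in 𝓝[<] β, q β') : ∃ β', p β' ∧ q β' := by
  obtain ⟨l, hl, h⟩ := (mem_nhdsLT_iff_exists_Ioo_subset).1 hq
  obtain ⟨β', h1, h2⟩ := (MeasureTheory.Measure.dense_of_ae hp).exists_between hl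
  exact ⟨β', h1, h h2⟩

theorem exists_ae_of_eventually_right {p q : ℝ → Prop} (hp : ∀ᵐ β, p β) {β : ℝ}
    (hq : ∀ᶠ β' in 𝓝[>] β, q β') : ∃ β', p β' ∧ q β' := by
  obtain ⟨l, hl, h⟩ := (mem_nhdsGT_iff_exists_Ioo_subset).1 hq
  obtain ⟨β', h1, h2⟩ := (MeasureTheory.Measure.dense_of_ae hp).exists_between hl
  exact ⟨β', h1, h h2⟩

/-! ### States next to a jump as values on rays; large jumps -/

namespace JumpTracking

variable {N : ℕ} {law : State N → List (Jump N) → Prop} {T Λ : ℝ} {J : JumpTracking N law T Λ}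

theorem eventually_between_rays {i : ℕ} {t x c e : ℝ} (hi' : t < J.time (i + 1))
    {F : Jump N} (hc : ray x T c t < F.pos t) (he : F.pos t < ray x T e t) :
    ∀ᶠ s in 𝓝[>] t, (t < s ∧ s < J.time (i + 1)) ∧ ray x T c s < F.pos s ∧
      F.pos s < ray x T e s := by
  have h1 := (continuous_ray_time x T c).continuousAt.eventually_lt F.continuous_pos.continuousAt hc
  have h2 := F.continuous_pos.continuousAt.eventually_lt (continuous_ray_time x T e).continuousAt he
  filter_upwards [h1.filter_mono nhdsWithin_le_nhds, h2.filter_mono nhdsWithin_le_nhds,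
    self_mem_nhdsWithin, (eventually_lt_nhds hi').filter_mono nhdsWithin_le_nhds] with s a b c d
  exact ⟨⟨c, d⟩, a, b⟩

variable {U : ℝ → ℝ → State N}
  (hU : ∀ i t, J.time i ≤ t → t < J.time (i + 1) → ∀ x, U x t = stepValue J.base (J.stage i) x t)

include hU

/-- The states next to a jump between two rays are values of `U` between these rays. -/
theorem exists_ray_eq_left_right {i : ℕ} {t x c e : ℝ} (hi : J.time i ≤ t)
    (hi' : t < J.time (i + 1)) {F : Jump N} (hF : F ∈ J.stage i) (hc : ray x T c t < F.pos t)
    (he : F.pos t < ray x T e t) {p : ℝ → Prop} (hp : ∀ᵐ β, p β) :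
    (∃ β ∈ Ioo c e, p β ∧ ∃ s ∈ Ioo t T, U (ray x T β s) s = F.left) ∧
      ∃ β ∈ Ioo c e, p β ∧ ∃ s ∈ Ioo t T, U (ray x T β s) s = F.right := by
  -- A slightly later time is used because jumps may still coincide at the time `t`, if an event has
  -- just happened. The states next to `F` do not change in between.
  obtain ⟨s, ⟨hs, hs'⟩, hsc, hse⟩ := (eventually_between_rays hi' hc he).exists
  have hsT : s < T := hs'.trans_le (J.time_le _)
  obtain ⟨A, B, hAB⟩ := List.append_of_mem hF
  have hsort := J.sorted i s (hi.trans_lt hs) hs'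
  obtain ⟨β, hβ⟩ := exists_ray_eq x T (F.pos s) hsT
  rw [← hβ, ray_lt_ray hsT] at hsc hse
  constructor
  · have h1 := stepValue_eventually_left hAB (J.adjoined i) hsort
    rw [← hβ] at h1
    obtain ⟨β', h2, h3, h4, h5⟩ := exists_ae_of_eventually_left hp
      (((tendsto_ray_left x T β hsT).eventually h1).and
        ((eventually_mem_nhdsWithin (s := Iio β)).and
          ((eventually_gt_nhds hsc).filter_mono nhdsWithin_le_nhds)))
    exact ⟨β', ⟨h5, lt_trans h4 hse⟩, h2, s, ⟨hs, hsT⟩,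
      (hU i s (hi.trans hs.le) hs' _).trans h3⟩
  · have h1 := stepValue_eventually_right hAB (J.adjoined i) hsort
    rw [← hβ] at h1
    obtain ⟨β', h2, h3, h4, h5⟩ := exists_ae_of_eventually_right hp
      (((tendsto_ray_right x T β hsT).eventually h1).and
        ((eventually_mem_nhdsWithin (s := Ioi β)).and
          ((eventually_lt_nhds hse).filter_mono nhdsWithin_le_nhds)))
    exact ⟨β', ⟨lt_trans hsc h4, h5⟩, h2, s, ⟨hs, hsT⟩,
      (hU i s (hi.trans hs.le) hs' _).trans h3⟩

/-- Large jumps between the rays with the slopes `-A` and `A` move along rays. -/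
theorem pos_eq_of_lt_norm_height {x A : ℝ} {V : ℝ → State N} {δ t₀ : ℝ}
    (hV : RayClose U x T A V δ t₀) {i : ℕ} {t : ℝ} (ht : t₀ ≤ t) (hi : J.time i ≤ t)
    (hi' : t < J.time (i + 1)) {F : Jump N} (hF : F ∈ J.stage i)
    (hc : ray x T (-A) t < F.pos t) (he : F.pos t < ray x T A t) (hδ : 4 * δ < ‖F.height‖) :
    F.pos T = x := by
  -- During `(t, u)` the jump `F` stays in its stage and between the rays. At each such time `s` it
  -- hits a ray, of slope `b s`, and all these rays are compared at one fixed time `r`.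
  obtain ⟨u, hu, hu'⟩ :=
    (mem_nhdsGT_iff_exists_Ioo_subset).1 (eventually_between_rays hi' hc he)
  have hu : t < u := hu
  obtain ⟨r, hr⟩ := exists_between hu
  have hrT : ∀ s ∈ Ioo t u, s < T := fun s hs => (hu' hs).1.2.trans_le (J.time_le _)
  choose! b hb using fun s (hs : s ∈ Ioo t u) => exists_ray_eq x T (F.pos s) (hrT s hs)
  have hrs := hu' hr
  obtain ⟨P, Q, hPQ⟩ := List.append_of_mem hF
  -- at the time `r`, there are jumps on all the rays that are hit by `F`
  have hmaps : MapsTo (fun s => ray x T (b s) r) (Ioo t u)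
      ((fun G : Jump N => G.pos r) '' {G | G ∈ J.stage i}) := by
    intro s hs
    by_contra hcon
    have hss := hu' hs
    have hsort := J.sorted i s (hi.trans_lt hs.1) hss.1.2
    have hbs := hss.2
    rw [← hb s hs, ray_lt_ray (hrT s hs), ray_lt_ray (hrT s hs)] at hbs
    have hconst := stepValue_eventually_const (a := J.base) (l := J.stage i) (t := r)
      (x := ray x T (b s) r) fun G hG h => hcon ⟨G, hG, h⟩
    have hconst := (continuous_ray x T r).continuousAt.tendsto.eventually hconst
    have hl := stepValue_eventually_left hPQ (J.adjoined i) hsort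
    have hr' := stepValue_eventually_right hPQ (J.adjoined i) hsort
    rw [← hb s hs] at hl hr'
    obtain ⟨β, h1, h2, h3, h4⟩ := (((tendsto_ray_left x T (b s) (hrT s hs)).eventually hl).and
      ((hconst.filter_mono nhdsWithin_le_nhds).and ((eventually_mem_nhdsWithin (s := Iio (b s))).and
        ((eventually_gt_nhds hbs.1).filter_mono nhdsWithin_le_nhds)))).exists
    obtain ⟨β', h1', h2', h3', h4'⟩ :=
      (((tendsto_ray_right x T (b s) (hrT s hs)).eventually hr').and
      ((hconst.filter_mono nhdsWithin_le_nhds).and ((eventually_mem_nhdsWithin (s := Ioi (b s))).and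
        ((eventually_lt_nhds hbs.2).filter_mono nhdsWithin_le_nhds)))).exists
    have h3 : β < b s := h3
    have h3' : b s < β' := h3'
    have hβ : β ∈ Icc (-A) A := ⟨h4.le, by linarith⟩
    have hβ' : β' ∈ Icc (-A) A := ⟨by linarith, h4'.le⟩
    have k1 := hV s ⟨ht.trans hs.1.le, hrT s hs⟩ β hβ
    have k2 := hV s ⟨ht.trans hs.1.le, hrT s hs⟩ β' hβ'
    have k3 := hV r ⟨ht.trans hr.1.le, hrT r hr⟩ β hβ
    have k4 := hV r ⟨ht.trans hr.1.le, hrT r hr⟩ β' hβ'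
    rw [hU i s (hi.trans hs.1.le) hss.1.2, h1] at k1
    rw [hU i s (hi.trans hs.1.le) hss.1.2, h1'] at k2
    rw [hU i r (hi.trans hr.1.le) hrs.1.2, h2] at k3
    rw [hU i r (hi.trans hr.1.le) hrs.1.2, h2'] at k4
    -- If no jump is on this ray at time `r`, then `U` has the same value there on both nearby rays.
    -- The height of `F` is thus a combination of four deviations from `V`, each at most `δ`.
    have e : F.height = (F.right - V β') - (F.left - V β) -
        ((stepValue J.base (J.stage i) (ray x T (b s) r) r - V β') -
          (stepValue J.base (J.stage i) (ray x T (b s) r) r - V β)) := by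
      rw [Jump.right]; abel
    have := norm_sub_le ((F.right - V β') - (F.left - V β))
      ((stepValue J.base (J.stage i) (ray x T (b s) r) r - V β') -
          (stepValue J.base (J.stage i) (ray x T (b s) r) r - V β))
    rw [← e] at this
    have j1 := norm_sub_le (F.right - V β') (F.left - V β)
    have j2 := norm_sub_le (stepValue J.base (J.stage i) (ray x T (b s) r) r - V β')
      (stepValue J.base (J.stage i) (ray x T (b s) r) r - V β)
    linarith
  -- Infinitely many times, but finitely many positions at time `r`: the line of `F` meets one ray
  -- twice, hence is that ray.
  obtain ⟨s, hs, s', hs', hne, heq⟩ := (Ioo_infinite hu).exists_ne_map_eq_of_mapsTo hmaps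
    ((List.finite_toSet _).image _)
  have hb' : b s = b s' := by
    have := (ray_le_ray (x := x) (hrT r hr)).1 heq.le
    have := (ray_le_ray (x := x) (hrT r hr)).1 heq.ge
    linarith
  have e1 := hb s hs
  have e2 := hb s' hs'
  rw [← hb'] at e2
  unfold ray Jump.pos at e1 e2
  have e3 : (b s + F.speed) * (s - s') = 0 := by linarith
  have e4 := (mul_eq_zero.1 e3).resolve_right (sub_ne_zero.2 hne)
  unfold Jump.pos
  have : F.speed = - b s := by linarith
  rw [this] at e1 ⊢
  linarith

end JumpTracking

/-! ### Criteria for at most one outgoing jump, in the cone and in domains of dependence -/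

/-- In a compact set of states, emissions between close states produce at most one jump, and
if they produce several jumps then all of these are large. -/
def EmissionLaw {N : ℕ} (Ω : Set (State N)) (law : State N → List (Jump N) → Prop) : Prop :=
  ∀ K, IsCompact K → K ⊆ Ω → ∃ d > 0, ∀ a O, law a O →
    (a ∈ K → ‖totalHeight O‖ < d → O.length ≤ 1) ∧
      (2 ≤ O.length → ∀ F ∈ O, F.left ∈ K → d ≤ ‖F.height‖)

theorem JumpStep.elim {N : ℕ} {law : State N → List (Jump N) → Prop} {t : ℝ}
    {l l' : List (Jump N)} (h : JumpStep law t l l') :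
    (∃ x a A I B O, IsEmission law t x a A I B O ∧ l = A ++ I ++ B ∧ l' = A ++ O ++ B) ∨
      ∃ A B F G, G.pos t = F.pos t ∧ G.left = F.left ∧ G.height = F.height ∧
        l = A ++ F :: B ∧ l' = A ++ G :: B := by
  cases h with
  | emission h => exact Or.inl ⟨_, _, _, _, _, _, h, rfl, rfl⟩
  | redirect _ h1 h2 h3 => exact Or.inr ⟨_, _, _, _, h1, h2, h3, rfl, rfl⟩

namespace JumpTracking

variable {N : ℕ} {law : State N → List (Jump N) → Prop} {T Λ : ℝ} {J : JumpTracking N law T Λ}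

/-- If the event after the stage `i` is an emission from `y`, then it produces at most one jump. -/
def Single (J : JumpTracking N law T Λ) (i : ℕ) (y : ℝ) : Prop :=
  ∀ a A I B O, IsEmission law (J.time (i + 1)) y a A I B O → J.stage i = A ++ I ++ B →
    J.stage (i + 1) = A ++ O ++ B → O.length ≤ 1

section trapezoid

/-- In the domain of dependence of an interval on which the states are close to each other,
emissions produce at most one jump. -/
theorem single_of_close {Y : Set (State N)} {d : ℝ}
    (hd : ∀ a O, law a O → a ∈ Y → ‖totalHeight O‖ < d → O.length ≤ 1)
    (hYd : ∀ u ∈ Y, ∀ v ∈ Y, ‖u - v‖ < d) {b c t₁ : ℝ} {i₁ : ℕ} (hi₁ : J.time i₁ ≤ t₁)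
    (hi₁' : t₁ < J.time (i₁ + 1))
    (hY : ∀ F ∈ J.stage i₁, b < F.pos t₁ → F.pos t₁ < c → F.left ∈ Y ∧ F.right ∈ Y)
    {i : ℕ} (h1 : t₁ < J.time (i + 1)) (h2 : J.time (i + 1) < T) {y : ℝ}
    (hy : b + Λ * (J.time (i + 1) - t₁) < y) (hy' : y < c - Λ * (J.time (i + 1) - t₁)) :
    J.Single i y := by
  -- The trapezoid shrinks with speed `Λ` from both sides, so no jump enters it, and all states in
  -- it remain in `Y`.
  let P : ℝ → List (Jump N) → Prop := fun s l => ∀ F ∈ l, b + Λ * (s - t₁) < F.pos s →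
    F.pos s < c - Λ * (s - t₁) → F.left ∈ Y ∧ F.right ∈ Y
  -- Both outer states of the emission are in `Y`, hence close. At most one jump emerges, and it
  -- joins these two states, so no state outside `Y` is created.
  have hone : ∀ t y a A I B O, IsEmission law t y a A I B O → P t (A ++ I ++ B) →
      b + Λ * (t - t₁) < y → y < c - Λ * (t - t₁) →
      a ∈ Y ∧ a + totalHeight O ∈ Y ∧ O.length ≤ 1 := by
    intro t y a A I B O h hP hy hy'
    have hmem : ∀ F ∈ I, F.left ∈ Y ∧ F.right ∈ Y := fun F hF =>
      hP F (by simp [hF]) (by rwa [h.incident F hF]) (by rwa [h.incident F hF])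
    obtain ⟨F, hF, rfl⟩ := h.left_mem
    obtain ⟨G, hG, hGe⟩ := exists_right_eq h.adjoined_in h.nonempty
    have k1 := (hmem F hF).1
    have k2 := (hmem G hG).2
    rw [hGe, ← h.total] at k2
    refine ⟨k1, k2, hd _ _ h.obeys k1 ?_⟩
    simpa using hYd _ k2 _ k1
  have hi : i₁ ≤ i := J.le_of_time hi₁ le_rfl h1
  have hP : P (J.time (i + 1)) (J.stage i) := by
    refine J.propagate (P := P) hi₁' ?_ ?_ ?_ hi h1.le (J.monotone_time (Nat.le_succ i)) h2
    · intro F hF k1 k2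
      exact hY F hF (by simpa using k1) (by simpa using k2)
    · intro j s s' _ hs _ hP F hF k1 k2
      have := abs_le.1 (J.pos_sub_le hF hs)
      exact hP F hF (by linarith) (by linarith)
    · intro j _ _ hP
      rcases (J.step j).elim with ⟨x, a, A, I, B, O, h, hl, hl'⟩ | ⟨A, B, F, G, e1, e2, e3, hl, hl'⟩
      · rw [hl] at hP
        rw [hl']
        intro F hF k1 k2
        rcases List.mem_append.1 hF with hF | hF
        · rcases List.mem_append.1 hF with hF | hF
          · exact hP F (by simp [hF]) k1 k2
          · rw [(h.emerging F hF).1] at k1 k2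
            obtain ⟨m1, m2, m3⟩ := hone _ _ _ _ _ _ _ h hP k1 k2
            have : O = [F] := by
              rcases O with _ | ⟨G, _ | ⟨_, _⟩⟩
              · simp at hF
              · rw [List.mem_singleton.1 hF]
              · simp at m3
            subst this
            have e := h.adjoined_out.1
            refine ⟨e ▸ m1, ?_⟩
            simpa [Jump.right, e] using m2
        · exact hP F (by simp [hF]) k1 k2
      · rw [hl] at hP
        rw [hl']
        intro F' hF' k1 k2
        rcases List.mem_append.1 hF' with hF' | hF'
        · exact hP F' (by simp [hF']) k1 k2
        · rcases List.mem_cons.1 hF' with rfl | hF'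
          · have := hP F (by simp) (by rwa [← e1]) (by rwa [← e1])
            simpa [Jump.right, e2, e3] using this
          · exact hP F' (by simp [hF']) k1 k2
  intro a A I B O h hl _
  rw [hl] at hP
  exact (hone _ _ _ _ _ _ _ h hP hy hy').2.2

end trapezoid

/-- The number of jumps between the rays into `x` with the slopes `-A` and `A` is bounded, if
emissions between them produce at most one jump. -/
theorem exists_countP_le {x A t₀ : ℝ} (hA : Λ ≤ A) (h0 : 0 ≤ t₀) (h0T : t₀ < T)
    (hs : ∀ i y, t₀ < J.time (i + 1) → J.time (i + 1) < T →
      ray x T (-A) (J.time (i + 1)) < y → y < ray x T A (J.time (i + 1)) → J.Single i y) :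
    ∃ n : ℕ, ∀ i t, t₀ ≤ t → J.time i ≤ t → t < J.time (i + 1) →
      (J.stage i).countP (fun F => ray x T (-A) t < F.pos t ∧ F.pos t < ray x T A t) ≤ n := by
  obtain ⟨i₀, hi₀, hi₀'⟩ := J.exists_stage h0 h0T
  -- The count at `t₀` never increases: jumps have speed at most `Λ ≤ A`, so none enters the cone.
  refine ⟨_, fun i t ht hi hi' => J.propagate (P := fun t l =>
    l.countP (fun F => ray x T (-A) t < F.pos t ∧ F.pos t < ray x T A t) ≤
      (J.stage i₀).countP (fun F => ray x T (-A) t₀ < F.pos t₀ ∧ F.pos t₀ < ray x T A t₀))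
    hi₀' le_rfl ?_ ?_ (J.le_of_time hi₀ ht hi') ht hi (hi'.trans_le (J.time_le _))⟩
  · intro j s s' _ hss _ h
    refine le_trans (List.countP_mono_left fun F hF hin => ?_) h
    simp only [decide_eq_true_eq] at hin ⊢
    have h1 := abs_le.1 (J.pos_sub_le hF hss)
    have h2 : Λ * (s' - s) ≤ A * (s' - s) := by
      exact mul_le_mul_of_nonneg_right hA (by linarith)
    unfold ray at hin ⊢
    constructor <;> linarith
  · intro j h1 h2 hP
    refine le_trans ?_ hP
    rcases (J.step j).elim with ⟨y, a, P, I, Q, O, h, hl, hl'⟩ | ⟨P, Q, F, G, e1, e2, e3, hl, hl'⟩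
    · rw [hl, hl']
      simp only [List.countP_append]
      gcongr ?_ + ?_ + ?_
      · exact le_rfl
      -- In the cone, at most one jump replaces at least one incident jump; elsewhere the emerging
      -- jumps are not counted.
      · by_cases hy : ray x T (-A) (J.time (j + 1)) < y ∧ y < ray x T A (J.time (j + 1))
        · refine List.countP_le_length.trans ((hs j y h1 h2 hy.1 hy.2 _ _ _ _ _ h hl hl').trans ?_)
          obtain ⟨F, hF, -⟩ := h.left_mem
          refine List.countP_pos_iff.2 ⟨F, hF, ?_⟩
          simpa [h.incident F hF] using hy
        · rw [List.countP_eq_zero.2]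
          · exact Nat.zero_le _
          · intro F hF
            simpa [(h.emerging F hF).1] using hy
      · exact le_rfl
    · rw [hl, hl']
      simp [List.countP_append, List.countP_cons, e1]

variable {U : ℝ → ℝ → State N}
  (hU : ∀ i t, J.time i ≤ t → t < J.time (i + 1) → ∀ x, U x t = stepValue J.base (J.stage i) x t)

include hU

/-- The states next to a jump are values of `U` on nearby rays with `V β ∈ K`, and `U` is `δ`-close
to `V` on these. The slopes are kept between `b` and `c`, for use where `V` is constant on such an
interval. -/
theorem left_right_mem {x A δ t₀ : ℝ} {V : ℝ → State N} (hV : RayClose U x T A V δ t₀)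
    {K K' : Set (State N)} (hK : ∀ᵐ β, β ∈ Icc (-A) A → V β ∈ K)
    (hK' : ∀ u, ∀ v ∈ K, ‖u - v‖ ≤ δ → u ∈ K') {i : ℕ} {t : ℝ} (ht : t₀ ≤ t)
    (hi : J.time i ≤ t) (hi' : t < J.time (i + 1)) {F : Jump N} (hF : F ∈ J.stage i) {b c : ℝ}
    (hb : -A ≤ b) (hc : c ≤ A) (h1 : ray x T b t < F.pos t) (h2 : F.pos t < ray x T c t) :
    (F.left ∈ K' ∧ ∃ β ∈ Ioo b c, ‖F.left - V β‖ ≤ δ) ∧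
      (F.right ∈ K' ∧ ∃ β ∈ Ioo b c, ‖F.right - V β‖ ≤ δ) := by
  obtain ⟨⟨β, hβ, hβK, s, hs, hsU⟩, ⟨β', hβ', hβK', s', hs', hsU'⟩⟩ :=
    exists_ray_eq_left_right hU hi hi' hF h1 h2 hK
  have m : β ∈ Icc (-A) A := ⟨hb.trans hβ.1.le, hβ.2.le.trans hc⟩
  have m' : β' ∈ Icc (-A) A := ⟨hb.trans hβ'.1.le, hβ'.2.le.trans hc⟩
  have k := hV s ⟨ht.trans hs.1.le, hs.2⟩ β m
  have k' := hV s' ⟨ht.trans hs'.1.le, hs'.2⟩ β' m'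
  rw [hsU] at k
  rw [hsU'] at k'
  exact ⟨⟨hK' _ _ (hβK m) k, β, hβ, k⟩, ⟨hK' _ _ (hβK' m') k', β', hβ', k'⟩⟩

/-- Emissions between the rays with slopes `-A` and `A` produce at most one jump. -/
theorem single_of_between {x A δ t₀ d : ℝ} {V : ℝ → State N} (hV : RayClose U x T A V δ t₀)
    {K K' : Set (State N)} (hK : ∀ᵐ β, β ∈ Icc (-A) A → V β ∈ K)
    (hK' : ∀ u, ∀ v ∈ K, ‖u - v‖ ≤ δ → u ∈ K')
    (hd : ∀ a O, law a O → 2 ≤ O.length → ∀ F ∈ O, F.left ∈ K' → d ≤ ‖F.height‖)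
    (hδ : 4 * δ < d) {i : ℕ} (h1 : t₀ ≤ J.time (i + 1)) (h2 : J.time (i + 1) < T) {y : ℝ}
    (hy : ray x T (-A) (J.time (i + 1)) < y) (hy' : y < ray x T A (J.time (i + 1))) :
    J.Single i y := by
  intro a P I Q O h hl hl'
  by_contra hlen
  set t := J.time (i + 1) with ht
  -- The result on large jumps needs a stage that lasts beyond `t`. The fan is therefore carried
  -- through all remaining events at this time, up to stage `k`.
  obtain ⟨k, hk, hk'⟩ := J.exists_stage (J.time_nonneg (i + 1)) h2
  have hik : i + 1 ≤ k := J.le_of_time le_rfl le_rfl hk'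
  have hfan : ∀ m, i + 1 ≤ m → m ≤ k →
      Fan (fun F : Jump N => F.left ∈ K' → d ≤ ‖F.height‖) y t (J.stage m) := by
    intro m hm
    induction m, hm using Nat.le_induction with
    | base =>
      intro _
      refine ⟨O, by rw [hl']; exact h.filter_out, by omega, h.increasing, fun F hF =>
        ⟨hd a O h.obeys (by omega) F hF, (h.emerging F hF).2⟩⟩
    | succ m hm ih =>
      intro hmk
      have e : J.time (m + 1) = t := le_antisymm
        ((J.monotone_time hmk).trans hk) (J.monotone_time (by omega))
      have := J.step m
      rw [e] at this
      exact this.fan (ih (by omega))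
  obtain ⟨O', hO', hlen', hinc, hQ⟩ := hfan k hik le_rfl
  -- All jumps of the fan are large, so their lines pass through both `(y, t)` and `(x, T)`. This
  -- contradicts their different speeds.
  have hmem : ∀ F ∈ O', F.pos t = y ∧ F.pos T = x := by
    intro F hF
    have hF' := hF
    rw [← hO', List.mem_filter, decide_eq_true_eq] at hF'
    obtain ⟨hFk, hFy⟩ := hF'
    refine ⟨hFy, ?_⟩
    rw [← hFy] at hy hy'
    refine pos_eq_of_lt_norm_height hU hV h1 hk hk' hFk hy hy' ?_
    refine hδ.trans_le ((hQ F hF).1 ?_)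
    exact (left_right_mem hU hV hK hK' h1 hk hk' hFk le_rfl le_rfl hy hy').1.1
  obtain ⟨F, l, rfl⟩ := List.exists_cons_of_length_pos (show 0 < O'.length by omega)
  obtain ⟨G, l', rfl⟩ := List.exists_cons_of_length_pos
    (show 0 < l.length by rw [List.length_cons] at hlen'; omega)
  have hFG : F.speed < G.speed := (List.pairwise_cons.1 hinc).1 G (by simp)
  obtain ⟨f1, f2⟩ := hmem F (by simp)
  obtain ⟨g1, g2⟩ := hmem G (by simp)
  have f3 := F.pos_add t T
  have g3 := G.pos_add t T
  have : F.speed * (T - t) = G.speed * (T - t) := by linarith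
  exact hFG.ne (mul_right_cancel₀ (sub_pos.2 h2).ne' this)

/-- The limit does not depend on rays that are faster than all jumps. -/
theorem limit_eq {x A t₁ : ℝ} {V : ℝ → State N} (h0 : 0 ≤ t₁) (h1T : t₁ < T)
    (hV : ∀ δ > 0, ∃ t₀ < T, RayClose U x T A V δ t₀) {n : ℕ}
    (hn : ∀ i t, t₁ ≤ t → J.time i ≤ t → t < J.time (i + 1) →
      (J.stage i).countP (fun F => ray x T (-A) t < F.pos t ∧ F.pos t < ray x T A t) ≤ n)
    {β β' : ℝ} (hβ : -A < β) (hβ' : β' < A) (hle : β ≤ β') (hΛ : ∀ γ ∈ Icc β β', Λ < |γ|) :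
    V β = V β' := by
  rw [← sub_eq_zero, ← norm_le_zero_iff]
  refine le_of_forall_pos_le_add fun ε hε => ?_
  rw [zero_add]
  -- Two comparisons of `V` with `U` cost `2δ`, and at most `n` jumps of size `4δ` lie in between.
  -- The bound `n` does not depend on `δ`.
  set δ := ε / (4 * n + 2) with hδ
  have hδ0 : 0 < δ := by positivity
  have hδε : 2 * δ + 4 * δ * n = ε := by rw [hδ]; field_simp; ring
  obtain ⟨t₀, ht₀, hclose⟩ := hV δ hδ0
  set t := max t₀ t₁ with ht
  have htT : t < T := max_lt ht₀ h1T
  obtain ⟨i, hi, hi'⟩ := J.exists_stage (h0.trans (le_max_right t₀ t₁)) htT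
  -- A larger jump would run along a ray with slope in `[β, β']`, and so faster than `Λ`.
  have hsmall : ∀ F ∈ J.stage i, ray x T β t ≤ F.pos t → F.pos t ≤ ray x T β' t →
      ‖F.height‖ ≤ 4 * δ := by
    intro F hF h1 h2
    by_contra! hlt
    have h3 := (ray_lt_ray (x := x) htT).2 hβ
    have h4 := (ray_lt_ray (x := x) htT).2 hβ'
    have h5 := pos_eq_of_lt_norm_height hU hclose (le_max_left t₀ t₁) hi hi' hF (h3.trans_le h1)
      (h2.trans_lt h4) hlt
    obtain ⟨γ, hγ⟩ := exists_ray_eq x T (F.pos t) htT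
    rw [← hγ, ray_le_ray htT] at h1 h2
    have h6 := J.pos_sub_le hF htT.le
    rw [h5, ← hγ, ray, sub_add_cancel_left, abs_neg, abs_mul, abs_of_pos (sub_pos.2 htT)] at h6
    exact absurd (le_of_mul_le_mul_right h6 (sub_pos.2 htT)) (not_le.2 (hΛ γ ⟨h1, h2⟩))
  have hdiff : ‖U (ray x T β' t) t - U (ray x T β t) t‖ ≤ 4 * δ * n := by
    rw [hU i t hi hi', hU i t hi hi', stepValue_sub]
    refine (norm_list_sum_le _ _).trans ?_
    have hcount := hn i t (le_max_right _ _) hi hi'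
    refine le_trans ?_ (mul_le_mul_of_nonneg_left (Nat.cast_le.2 hcount) (by positivity))
    have hgen : ∀ l : List (Jump N), (∀ F ∈ l, ray x T β t ≤ F.pos t → F.pos t ≤ ray x T β' t →
        ‖F.height‖ ≤ 4 * δ) → (l.map fun F => ‖(heaviside (ray x T β' t - F.pos t) -
          heaviside (ray x T β t - F.pos t)) • F.height‖).sum ≤ 4 * δ * (l.countP fun F =>
          ray x T (-A) t < F.pos t ∧ F.pos t < ray x T A t : ℕ) := by
      intro l hl
      induction l with
      | nil => simp
      | cons F l ih =>
        have ih := ih fun G hG => hl G (by simp [hG])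
        have hray := (ray_le_ray (x := x) htT).2 hle
        rw [List.map_cons, List.sum_cons, List.countP_cons]
        by_cases hin : ray x T β t ≤ F.pos t ∧ F.pos t ≤ ray x T β' t
        · have h3 := ((ray_lt_ray (x := x) htT).2 hβ).trans_le hin.1
          have h4 := hin.2.trans_lt ((ray_lt_ray (x := x) htT).2 hβ')
          have h5 := hl F (by simp) hin.1 hin.2
          have h6 := heaviside_mem (ray x T β' t - F.pos t)
          have h7 := heaviside_mem (ray x T β t - F.pos t)
          have h8 : ‖(heaviside (ray x T β' t - F.pos t) -
              heaviside (ray x T β t - F.pos t)) • F.height‖ ≤ ‖F.height‖ := by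
            rw [norm_smul]
            refine mul_le_of_le_one_left (norm_nonneg _) ?_
            rw [Real.norm_eq_abs, abs_le]
            constructor <;> linarith
          simp only [h3, h4, and_self, decide_true, if_true]
          push_cast
          linarith
        · have : heaviside (ray x T β' t - F.pos t) = heaviside (ray x T β t - F.pos t) := by
            rcases not_and_or.1 hin with h | h
            · rw [heaviside_of_pos (by linarith), heaviside_of_pos (by linarith)]
            · rw [heaviside_of_neg (by linarith), heaviside_of_neg (by linarith)]
          rw [this, sub_self, zero_smul, norm_zero, zero_add]
          refine ih.trans ?_
          gcongr
          exact Nat.le_add_right _ _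
    exact hgen _ hsmall
  have k1 := hclose t ⟨le_max_left _ _, htT⟩ β ⟨hβ.le, by linarith⟩
  have k2 := hclose t ⟨le_max_left _ _, htT⟩ β' ⟨by linarith, hβ'.le⟩
  have e : V β - V β' = (U (ray x T β' t) t - V β') - (U (ray x T β t) t - V β) -
      (U (ray x T β' t) t - U (ray x T β t) t) := by abel
  rw [e]
  have j1 := norm_sub_le ((U (ray x T β' t) t - V β') - (U (ray x T β t) t - V β))
    (U (ray x T β' t) t - U (ray x T β t) t)
  have j2 := norm_sub_le (U (ray x T β' t) t - V β') (U (ray x T β t) t - V β)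
  linarith

end JumpTracking

/-- Passes from speeds `α` to slopes `β = -α`, so that position increases with the parameter of the
ray. Reflection preserves Lebesgue measure and thus the exceptional null set. -/
theorem AlphaRayCondition.exists_limit {N : ℕ} {Ω : Set (State N)} {U : ℝ → ℝ → State N}
    {x T : ℝ} (h : AlphaRayCondition Ω U x T) (A : ℝ) :
    ∃ V : ℝ → State N, (∀ δ > 0, ∃ t₀ < T, RayClose U x T A V δ t₀) ∧
      ∃ K, IsCompact K ∧ K ⊆ Ω ∧ ∀ᵐ β, β ∈ Icc (-A) A → V β ∈ K := by
  obtain ⟨V, hV⟩ := h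
  obtain ⟨hlim, K, hK, hKΩ, hae⟩ := hV (-A) A
  refine ⟨fun β => V (-β), fun δ hδ => ?_, K, hK, hKΩ, ?_⟩
  · obtain ⟨l, hl, hl'⟩ := (mem_nhdsLT_iff_exists_Ioo_subset).1
      (Metric.tendstoUniformlyOn_iff.1 hlim δ hδ)
    obtain ⟨t₀, h1, h2⟩ := exists_between (show l < T from hl)
    refine ⟨t₀, h2, fun t ht β hβ => ?_⟩
    have := hl' ⟨h1.trans_le ht.1, ht.2⟩ (-β) ⟨by linarith [hβ.2], by linarith [hβ.1]⟩
    rw [dist_comm, dist_eq_norm] at this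
    have e : x + -β * (t - T) = ray x T β t := by unfold ray; ring
    rw [e] at this
    exact this.le
  · filter_upwards [(MeasureTheory.Measure.measurePreserving_neg
      MeasureTheory.volume).quasiMeasurePreserving.ae hae] with β hβ h
    exact hβ ⟨by linarith [h.2], by linarith [h.1]⟩

/-! ### From the ray condition at single points to a bound on all jumps -/

namespace JumpTracking

variable {N : ℕ} {law : State N → List (Jump N) → Prop} {T Λ : ℝ} {J : JumpTracking N law T Λ}
variable {U : ℝ → ℝ → State N}
  (hU : ∀ i t, J.time i ≤ t → t < J.time (i + 1) → ∀ x, U x t = stepValue J.base (J.stage i) x t)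

include hU

/-- Near a point at which the ray condition holds, emissions produce at most one jump. -/
theorem exists_nhds_single {Ω : Set (State N)} (hΩ : IsOpen Ω) (hlaw : EmissionLaw Ω law)
    (hΛ : 0 ≤ Λ) (hT : 0 < T) {x : ℝ} (h : AlphaRayCondition Ω U x T) :
    ∃ ρ > 0, ∃ t₂ < T, ∀ i y, t₂ < J.time (i + 1) → J.time (i + 1) < T → |y - x| < ρ →
      J.Single i y := by
  -- A domain of dependence based between the slopes `Λ + 1` and `3Λ + 3` at time `t₁` narrows by at
  -- most `Λ (T - t₁)` on each side up to time `T`. So it always contains the position with slope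
  -- `2Λ + 2` at `t₁`, with room to spare.
  set A := 3 * Λ + 3 with hA
  set C := Λ + 1 with hC
  obtain ⟨V, hV, K, hK, hKΩ, hae⟩ := h.exists_limit A
  obtain ⟨δ₁, hδ₁, hδΩ⟩ := hK.exists_cthickening_subset_open hΩ hKΩ
  have hK' : IsCompact (Metric.cthickening δ₁ K) := hK.cthickening
  obtain ⟨d, hd, hdlaw⟩ := hlaw _ hK' hδΩ
  -- The first bound keeps states that are `δ`-close to `K` in the compact thickening; the second
  -- gives `4δ < d`, which serves large jumps as well as the diameter `2δ` of a set of nearly equal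
  -- states.
  set δ := min δ₁ (d / 8) with hδ
  have hδ0 : 0 < δ := lt_min hδ₁ (by positivity)
  have hδd : 4 * δ < d := by linarith [min_le_right δ₁ (d / 8)]
  have hmemK : ∀ u, ∀ v ∈ K, ‖u - v‖ ≤ δ → u ∈ Metric.cthickening δ₁ K := fun u v hv huv =>
    Metric.mem_cthickening_of_dist_le u v δ₁ K hv
      ((dist_eq_norm u v).le.trans (huv.trans (min_le_left _ _)))
  obtain ⟨t', ht'T, hclose'⟩ := hV δ hδ0
  set t₀ := max t' 0 with ht₀
  have h0 : 0 ≤ t₀ := le_max_right _ _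
  have h0T : t₀ < T := max_lt ht'T hT
  have hclose : RayClose U x T A V δ t₀ := fun t ht β hβ =>
    hclose' t ⟨(le_max_left _ _).trans ht.1, ht.2⟩ β hβ
  have hcone : ∀ i y, t₀ < J.time (i + 1) → J.time (i + 1) < T →
      ray x T (-A) (J.time (i + 1)) < y → y < ray x T A (J.time (i + 1)) → J.Single i y :=
    fun i y h1 h2 h3 h4 => single_of_between hU hclose hae hmemK
      (fun a O hO => (hdlaw a O hO).2) hδd h1.le h2 h3 h4
  obtain ⟨n, hn⟩ := exists_countP_le (J := J) (x := x) (A := A) (by linarith) h0 h0T hcone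
  -- emissions off the cone, which is spanned by the rays with the slopes `b` and `c`
  have houter : ∀ b c, -A ≤ b → c ≤ A → (∀ γ ∈ Ioo b c, Λ < |γ|) → ∀ t₁, t₀ ≤ t₁ →
      ∀ i y, t₁ < J.time (i + 1) → J.time (i + 1) < T →
      ray x T b t₁ + Λ * (J.time (i + 1) - t₁) < y →
      y < ray x T c t₁ - Λ * (J.time (i + 1) - t₁) → J.Single i y := by
    intro b c hb hc hbc t₁ ht₁ i y h1 h2 h3 h4
    have h1T := h1.trans h2
    have hbc' : b < c := by
      have : 0 ≤ Λ * (J.time (i + 1) - t₁) := mul_nonneg hΛ (by linarith)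
      exact (ray_lt_ray (x := x) h1T).1 (by linarith)
    -- All slopes in `(b, c)` exceed `Λ` in absolute value; hence at time `t₁` all states seen
    -- between the two rays are `δ`-close to one single state.
    have hconst : ∀ β ∈ Ioo b c, V β = V ((b + c) / 2) := by
      intro β hβ
      rcases le_total β ((b + c) / 2) with hle | hle
      · exact limit_eq hU h0 h0T hV hn (by linarith [hβ.1]) (by linarith) hle fun γ hγ =>
          hbc γ ⟨hβ.1.trans_le hγ.1, by linarith [hγ.2]⟩
      · exact (limit_eq hU h0 h0T hV hn (by linarith) (by linarith [hβ.2]) hle fun γ hγ =>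
          hbc γ ⟨by linarith [hγ.1], hγ.2.trans_lt hβ.2⟩).symm
    obtain ⟨i₁, hi₁, hi₁'⟩ := J.exists_stage (h0.trans ht₁) h1T
    refine single_of_close
      (Y := {u | u ∈ Metric.cthickening δ₁ K ∧ ‖u - V ((b + c) / 2)‖ ≤ δ}) (d := d)
      (fun a O hO ha => (hdlaw a O hO).1 ha.1) ?_ hi₁ hi₁' ?_ h1 h2 h3 h4
    · intro u hu v hv
      have := norm_sub_le (u - V ((b + c) / 2)) (v - V ((b + c) / 2))
      rw [sub_sub_sub_cancel_right] at this
      linarith [hu.2, hv.2]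
    · intro F hF k1 k2
      obtain ⟨⟨m1, β, hβ, m2⟩, m3, β', hβ', m4⟩ := left_right_mem hU hclose hae hmemK ht₁ hi₁ hi₁'
        hF hb hc k1 k2
      rw [hconst β hβ] at m2
      rw [hconst β' hβ'] at m4
      exact ⟨⟨m1, m2⟩, m3, m4⟩
  set B := 2 * Λ + 2 with hB
  have hB0 : 0 < B := by positivity
  refine ⟨B * (T - t₀), mul_pos hB0 (by linarith), t₀, h0T, fun i y h1 h2 hy => ?_⟩
  set t := J.time (i + 1) with ht
  rcases lt_or_ge (|y - x|) (A * (T - t)) with hin | hout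
  · have := abs_lt.1 hin
    exact hcone i y h1 h2 (by unfold ray; linarith) (by unfold ray; linarith)
  -- The time at which the position `y` is on a ray of slope `±B`. It is after `t₀` because `|y - x|
  -- < B (T - t₀)`, and before `t` because `A > B`.
  · set t₁ := T - |y - x| / B with ht₁
    have e : |y - x| = B * (T - t₁) := by rw [ht₁]; field_simp; ring
    rw [e] at hout hy
    have hTt : 0 < T - t := by linarith
    have k1 : t₀ ≤ t₁ := by
      have := lt_of_mul_lt_mul_left hy hB0.le
      linarith
    have k2 : t₁ < t := by
      have : B * (T - t) < B * (T - t₁) := lt_of_lt_of_le (by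
        apply mul_lt_mul_of_pos_right _ hTt; linarith) hout
      have := lt_of_mul_lt_mul_left this hB0.le
      linarith
    have k3 : Λ * (t - t₁) ≤ Λ * (T - t₁) := mul_le_mul_of_nonneg_left (by linarith) hΛ
    have k4 : 0 < T - t₁ := by linarith
    rcases abs_cases (y - x) with ⟨ha, -⟩ | ⟨ha, -⟩
    · refine houter C A (by linarith) le_rfl (fun γ hγ => ?_) t₁ k1 i y k2 h2 ?_ ?_
      · exact lt_of_lt_of_le (by linarith [hγ.1]) (le_abs_self γ)
      all_goals
        rw [ha] at e
        unfold ray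
        simp only [hA, hB, hC] at e ⊢
        linarith
    · refine houter (-A) (-C) le_rfl (by linarith) (fun γ hγ => ?_) t₁ k1 i y k2 h2 ?_ ?_
      · exact lt_of_lt_of_le (by linarith [hγ.2]) (neg_le_abs γ)
      all_goals
        rw [ha] at e
        unfold ray
        simp only [hA, hB, hC] at e ⊢
        linarith

/-- If the ray condition holds at all points, then the total size of all jumps is bounded. -/
theorem exists_totalSize_le {Ω : Set (State N)} (hΩ : IsOpen Ω) (hlaw : EmissionLaw Ω law)
    (hΛ : 0 ≤ Λ) (hT : 0 < T) (h : ∀ x, AlphaRayCondition Ω U x T) :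
    ∃ t₀ < T, ∃ R, ∀ i t, t₀ ≤ t → J.time i ≤ t → t < J.time (i + 1) →
      totalSize (J.stage i) ≤ R := by
  obtain ⟨R, hR⟩ := J.exists_forall_abs_pos_le hΛ
  obtain ⟨t₂, ht₂, hs⟩ : ∃ t₂ < T, ∀ i, ∀ y ∈ Icc (-R) R, t₂ < J.time (i + 1) →
      J.time (i + 1) < T → J.Single i y := by
    refine (isCompact_Icc (a := -R) (b := R)).induction_on (p := fun s => ∃ t₂ < T, ∀ i, ∀ y ∈ s,
      t₂ < J.time (i + 1) → J.time (i + 1) < T → J.Single i y) ⟨0, hT, by simp⟩ ?_ ?_ ?_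
    · rintro s s' hss ⟨t₂, ht₂, hs⟩
      exact ⟨t₂, ht₂, fun i y hy => hs i y (hss hy)⟩
    · rintro s s' ⟨t₂, ht₂, hs⟩ ⟨t₂', ht₂', hs'⟩
      refine ⟨max t₂ t₂', max_lt ht₂ ht₂', fun i y hy h1 h2 => ?_⟩
      rw [max_lt_iff] at h1
      exact hy.elim (fun hy => hs i y hy h1.1 h2) (fun hy => hs' i y hy h1.2 h2)
    · intro x _
      obtain ⟨ρ, hρ, t₂, ht₂, hs⟩ := exists_nhds_single hU hΩ hlaw hΛ hT (h x)
      refine ⟨Metric.ball x ρ, mem_nhdsWithin_of_mem_nhds (Metric.ball_mem_nhds x hρ), t₂, ht₂,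
        fun i y hy h1 h2 => hs i y h1 h2 ?_⟩
      simpa [Real.dist_eq] using hy
  set t₀ := max t₂ 0 with ht₀
  have h0T : t₀ < T := max_lt ht₂ hT
  obtain ⟨i₀, hi₀, hi₀'⟩ := J.exists_stage (le_max_right t₂ 0) h0T
  refine ⟨t₀, h0T, totalSize (J.stage i₀), fun i t ht hi hi' =>
    J.propagate (P := fun _ l => totalSize l ≤ totalSize (J.stage i₀)) hi₀' le_rfl
      (fun _ _ _ _ _ _ h => h) (fun j h1 h2 hP => le_trans ?_ hP) (J.le_of_time hi₀ ht hi')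
      ht hi (hi'.trans_le (J.time_le _))⟩
  rcases (J.step j).elim with ⟨y, a, P, I, Q, O, h, hl, hl'⟩ | ⟨P, Q, F, G, _, _, e3, hl, hl'⟩
  · have hy : y ∈ Icc (-R) R := by
      obtain ⟨F, hF, -⟩ := h.left_mem
      have := hR j _ (J.monotone_time (Nat.le_succ j)) h2 F (by simp [hl, hF])
      rw [Nat.succ_eq_add_one, h.incident F hF] at this
      exact abs_le.1 this
    have hO := hs j y hy ((le_max_left _ _).trans_lt h1) h2 _ _ _ _ _ h hl hl'
    -- A single emerging jump has the total height of the incident ones.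
    have h3 : totalSize O ≤ totalSize I := by
      rcases O with _ | ⟨F, _ | ⟨_, _⟩⟩
      · simpa [totalSize] using totalSize_nonneg I
      · have := norm_totalHeight_le I
        rw [← h.total] at this
        simpa [totalSize, totalHeight] using this
      · simp at hO
    rw [hl, hl']
    simp only [totalSize, List.map_append, List.sum_append] at h3 ⊢
    linarith
  · rw [hl, hl']
    simp [totalSize, e3]

end JumpTracking

/-! ## Local solvability of generalized Riemann problems -/

/-- A `C¹` vector field has a local flow, which is strictly differentiable at the time `0`. -/
theorem exists_local_flow {E : Type*} [NormedAddCommGroup E] [NormedSpace ℝ E] [CompleteSpace E]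
    {r : E → E} {u₀ : E} (hr : ContDiffAt ℝ 1 r u₀) {s : Set E} (hs : s ∈ 𝓝 u₀) :
    ∃ W : E × ℝ → E, W (u₀, 0) = u₀ ∧
      HasStrictFDerivAt W (ContinuousLinearMap.fst ℝ E ℝ +
        (ContinuousLinearMap.snd ℝ E ℝ).smulRight (r u₀)) (u₀, 0) ∧
      ∀ᶠ p : E × ℝ in 𝓝 (u₀, 0), W (p.1, 0) = p.1 ∧ ∀ z ∈ uIcc 0 p.2, W (p.1, z) ∈ s ∧
        HasDerivWithinAt (fun z => W (p.1, z)) (r (W (p.1, z))) (uIcc 0 p.2) z := by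
  obtain ⟨ε, hε, a, ρ, L, K, hρ, hpl⟩ := IsPicardLindelof.of_contDiffAt_one hr
  obtain ⟨α, hα, L', hL'⟩ :=
    (hpl 0).exists_forall_mem_closedBall_eq_hasDerivWithinAt_lipschitzOnWith
  obtain ⟨K', s', hs', hK'⟩ := hr.exists_lipschitzOnWith
  simp only [zero_sub, zero_add] at hα hL'
  have hρ' : (0 : ℝ) < ρ := hρ
  have hu₀ : α u₀ 0 = u₀ := (hα u₀ (Metric.mem_closedBall_self ρ.2)).1
  have hcont : ContinuousOn (fun p : E × ℝ => α p.1 p.2)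
      (Metric.closedBall u₀ ρ ×ˢ Icc (-ε) ε) :=
    continuousOn_prod_of_continuousOn_lipschitzOnWith (fun p : E × ℝ => α p.1 p.2) L'
      (fun x hx => HasDerivWithinAt.continuousOn (hα x hx).2) hL'
  have hcont0 : ContinuousAt (fun p : E × ℝ => α p.1 p.2) (u₀, 0) :=
    hcont.continuousAt (prod_mem_nhds (Metric.closedBall_mem_nhds u₀ hρ')
      (Icc_mem_nhds (by linarith) hε))
  have hbox : ∀ t ∈ 𝓝 u₀, ∃ η : ℝ, 0 < η ∧ η ≤ ρ ∧ η ≤ ε ∧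
      ∀ x ∈ Metric.closedBall u₀ η, ∀ z ∈ Icc (-η) η, α x z ∈ t := by
    intro t ht
    have h1 : ∀ᶠ p : E × ℝ in 𝓝 (u₀, 0), α p.1 p.2 ∈ t := by
      have := hcont0.tendsto
      simp only [hu₀] at this
      exact this ht
    obtain ⟨η, hη, h2⟩ := Metric.eventually_nhds_iff_ball.1 h1
    refine ⟨min (η / 2) (min ρ ε), lt_min (by positivity) (lt_min hρ' hε),
      (min_le_right _ _).trans (min_le_left _ _), (min_le_right _ _).trans (min_le_right _ _),
      fun x hx z hz => h2 (x, z) ?_⟩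
    rw [Metric.mem_ball, Prod.dist_eq]
    have hmin := min_le_left (η / 2) (min (ρ : ℝ) ε)
    refine max_lt ?_ ?_
    · exact (Metric.mem_closedBall.1 hx).trans_lt (by linarith)
    · change dist z 0 < η
      rw [Real.dist_0_eq_abs]
      exact (abs_le.2 hz).trans_lt (by linarith)
  refine ⟨fun p => α p.1 p.2, hu₀, ?_, ?_⟩
  -- Lipschitz dependence on the initial state, as given by Picard–Lindelöf, is enough for strict
  -- differentiability at time `0`; smoothness of the flow is not required.
  · refine HasStrictFDerivAt.of_isLittleO (Asymptotics.isLittleO_iff.2 fun c hc => ?_)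
    have hnhd : {v | v ∈ s' ∧ ‖r v - r u₀‖ ≤ c / 2} ∈ 𝓝 u₀ := by
      have := Metric.tendsto_nhds.1 hr.continuousAt.tendsto (c / 2) (by positivity)
      filter_upwards [hs', this] with v h1 hv
      exact ⟨h1, by rw [← dist_eq_norm]; exact hv.le⟩
    obtain ⟨η, hη, hηρ, hηε, hin⟩ := hbox _ hnhd
    set η' := min η (c / 2 / (K' * L' + 1)) with hη'
    have hη'0 : 0 < η' := lt_min hη (by positivity)
    have hη'c : K' * L' * η' ≤ c / 2 := by
      have h1 : η' ≤ c / 2 / (K' * L' + 1) := min_le_right _ _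
      rw [le_div_iff₀ (by positivity)] at h1
      nlinarith
    have hη'η : η' ≤ η := min_le_left _ _
    have hnb : ∀ᶠ p : E × ℝ in 𝓝 (u₀, 0), p.1 ∈ Metric.closedBall u₀ η' ∧ p.2 ∈ Icc (-η') η' := by
      exact prod_mem_nhds (Metric.closedBall_mem_nhds u₀ hη'0)
        (Icc_mem_nhds (by linarith) hη'0)
    rw [nhds_prod_eq]
    filter_upwards [hnb.prod_mk hnb] with ⟨⟨x, t⟩, ⟨y, t'⟩⟩ ⟨⟨hx, ht⟩, hy, ht'⟩
    simp only at hx ht hy ht'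
    have hsub : Icc (-η') η' ⊆ Icc (-ε) ε := Icc_subset_Icc (by linarith) (by linarith)
    have hsub' : Icc (-η') η' ⊆ Icc (-η) η := Icc_subset_Icc (by linarith) (by linarith)
    have hball : ∀ x ∈ Metric.closedBall u₀ η', x ∈ Metric.closedBall u₀ ρ := fun x hx =>
      Metric.closedBall_subset_closedBall (hη'η.trans hηρ) hx
    have hball' : ∀ x ∈ Metric.closedBall u₀ η', x ∈ Metric.closedBall u₀ η := fun x hx =>
      Metric.closedBall_subset_closedBall hη'η hx
    have hd : ∀ x ∈ Metric.closedBall u₀ η', ∀ z ∈ Icc (-η') η',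
        HasDerivWithinAt (α x) (r (α x z)) (Icc (-η') η') z := fun x hx z hz =>
      ((hα x (hball x hx)).2 z (hsub hz)).mono hsub
    have h0 : (0 : ℝ) ∈ Icc (-η') η' := ⟨by linarith, hη'0.le⟩
    -- The increment is split at `(y, t)`. Varying the initial state, the difference of two
    -- solutions has a derivative of size at most `K' L' ‖x - y‖` and acts only for a time `η'`.
    -- Varying the time, the derivative `r (α y z)` is close to `r u₀`.
    have e1 : ‖(α x t - α y t) - (x - y)‖ ≤ c / 2 * ‖x - y‖ := by
      have := Convex.norm_image_sub_le_of_norm_hasDerivWithin_le (s := Icc (-η') η')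
        (f := fun z => α x z - α y z) (C := K' * (L' * ‖x - y‖))
        (fun z hz => (hd x hx z hz).sub (hd y hy z hz)) (fun z hz => ?_) (convex_Icc _ _) h0 ht
      · simp only [(hα x (hball x hx)).1, (hα y (hball y hy)).1, sub_zero] at this
        refine this.trans ?_
        have h3 : ‖t‖ ≤ η' := abs_le.2 ht
        calc K' * (L' * ‖x - y‖) * ‖t‖ ≤ K' * (L' * ‖x - y‖) * η' := by gcongr
          _ = K' * L' * η' * ‖x - y‖ := by ring
          _ ≤ c / 2 * ‖x - y‖ := by gcongr
      · have m1 := (hin x (hball' x hx) z (hsub' hz)).1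
        have m2 := (hin y (hball' y hy) z (hsub' hz)).1
        refine (hK'.norm_sub_le m1 m2).trans ?_
        gcongr
        exact (hL' z (hsub hz)).norm_sub_le (hball x hx) (hball y hy)
    have e2 : ‖(α y t - t • r u₀) - (α y t' - t' • r u₀)‖ ≤ c / 2 * ‖t - t'‖ := by
      refine Convex.norm_image_sub_le_of_norm_hasDerivWithin_le (s := Icc (-η') η')
        (f := fun z => α y z - z • r u₀) (f' := fun z => r (α y z) - (1 : ℝ) • r u₀)
        (fun z hz => (hd y hy z hz).sub ((hasDerivWithinAt_id z _).smul_const _))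
        (fun z hz => ?_) (convex_Icc _ _) ht' ht
      rw [one_smul]
      exact (hin y (hball' y hy) z (hsub' hz)).2
    have e3 : α x t - α y t' - (ContinuousLinearMap.fst ℝ E ℝ +
        (ContinuousLinearMap.snd ℝ E ℝ).smulRight (r u₀)) ((x, t) - (y, t')) =
        ((α x t - α y t) - (x - y)) + ((α y t - t • r u₀) - (α y t' - t' • r u₀)) := by
      simp only [Prod.mk_sub_mk, add_apply, ContinuousLinearMap.coe_fst',
        ContinuousLinearMap.smulRight_apply, ContinuousLinearMap.coe_snd', sub_smul]
      abel
    change ‖α x t - α y t' - _‖ ≤ _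
    rw [e3]
    refine (norm_add_le _ _).trans ((add_le_add e1 e2).trans ?_)
    have n1 : ‖x - y‖ ≤ ‖((x, t) : E × ℝ) - (y, t')‖ :=
      norm_fst_le (((x, t) : E × ℝ) - (y, t'))
    have n2 : ‖t - t'‖ ≤ ‖((x, t) : E × ℝ) - (y, t')‖ :=
      norm_snd_le (((x, t) : E × ℝ) - (y, t'))
    nlinarith
  · obtain ⟨η, hη, hηρ, hηε, hin⟩ := hbox s hs
    have hnb : ∀ᶠ p : E × ℝ in 𝓝 (u₀, 0), p.1 ∈ Metric.closedBall u₀ η ∧ p.2 ∈ Icc (-η) η := by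
      exact prod_mem_nhds (Metric.closedBall_mem_nhds u₀ hη) (Icc_mem_nhds (by linarith) hη)
    filter_upwards [hnb] with p hp
    have hpρ := Metric.closedBall_subset_closedBall hηρ hp.1
    have hsub : uIcc 0 p.2 ⊆ Icc (-η) η := uIcc_subset_Icc ⟨by linarith, hη.le⟩ hp.2
    have hsub' : uIcc 0 p.2 ⊆ Icc (-ε) ε :=
      hsub.trans (Icc_subset_Icc (by linarith) (by linarith))
    exact ⟨(hα _ hpρ).1, fun z hz => ⟨hin _ hp.1 z (hsub hz),
      ((hα _ hpρ).2 z (hsub' hz)).mono hsub'⟩⟩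

/-! ### Wave curves near a state, and weak solutions for nearby data -/

namespace HyperbolicSystem

variable {N : ℕ} (S : HyperbolicSystem N)

theorem simpleWave_zero {k : Fin N} {u : State N} (hu : u ∈ S.states) : S.SimpleWave k u 0 u := by
  refine ⟨fun _ => u, rfl, rfl, fun z hz => ⟨hu, ?_⟩⟩
  rw [uIcc_self, mem_singleton_iff] at hz
  subst hz
  rw [uIcc_self]
  exact HasFDerivWithinAt.of_subsingleton (subsingleton_singleton)

/-- Simple waves near `u₀` are given by a strictly differentiable map. -/
theorem exists_simpleWave_map (k : Fin N) {u₀ : State N} (hu₀ : u₀ ∈ S.states) :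
    ∃ G : State N × ℝ → State N, G (u₀, 0) = u₀ ∧
      HasStrictFDerivAt G (ContinuousLinearMap.fst ℝ (State N) ℝ +
        (ContinuousLinearMap.snd ℝ (State N) ℝ).smulRight (S.r k u₀)) (u₀, 0) ∧
      ∀ᶠ p : State N × ℝ in 𝓝 (u₀, 0), S.SimpleWave k p.1 p.2 (G p) := by
  have hn := S.isOpen_states.mem_nhds hu₀
  obtain ⟨W, h0, hW, hev⟩ := exists_local_flow ((S.contDiffOn_r k).contDiffAt hn) hn
  refine ⟨W, h0, hW, hev.mono fun p hp => ⟨fun z => W (p.1, z), hp.1, rfl, hp.2⟩⟩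

/-- Elementary waves near `u₀` are given by a strictly differentiable map. -/
theorem exists_elementary_map (k : Fin N) {u₀ : State N} (hu₀ : u₀ ∈ S.states) :
    ∃ G : State N × ℝ → State N, G (u₀, 0) = u₀ ∧
      HasStrictFDerivAt G (ContinuousLinearMap.fst ℝ (State N) ℝ +
        (ContinuousLinearMap.snd ℝ (State N) ℝ).smulRight (S.r k u₀)) (u₀, 0) ∧
      ∀ᶠ p : State N × ℝ in 𝓝 (u₀, 0), S.Elementary k p.1 p.2 (G p) := by
  obtain ⟨W, h0, hW, hev⟩ := S.exists_simpleWave_map k hu₀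
  rcases S.gnl_or_linDeg k with hk | hk
  swap
  · exact ⟨W, h0, hW, hev.mono fun p hp => Or.inl ⟨Or.inl hk, hp⟩⟩
  have hEW : ∀ᶠ p : State N × ℝ in 𝓝 (u₀, 0), 0 ≤ p.2 → S.E k p.1 p.2 = W p :=
    hev.mono fun p hp h => S.E_rarefaction k hk _ _ _ h hp
  have hE0 : S.E k u₀ 0 = u₀ := by
    have := hEW.self_of_nhds le_rfl
    rwa [h0] at this
  have hstrict := (S.contDiffAt_E k hk u₀ hu₀).hasStrictFDerivAt one_ne_zero
  refine ⟨fun p => S.E k p.1 p.2, hE0, ?_, ?_⟩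
  -- The curve `E` is `C¹` and coincides with the flow on the half space `ζ ≥ 0`. This half space
  -- already determines the derivative, so no tangency condition for the shock branch is needed.
  · have huniq : UniqueDiffWithinAt ℝ {p : State N × ℝ | 0 ≤ p.2} (u₀, 0) := by
      have hset : {p : State N × ℝ | 0 ≤ p.2} = univ ×ˢ Ici (0 : ℝ) := by
        ext p; simp
      rw [hset]
      exact (uniqueDiffWithinAt_univ).prod ((uniqueDiffOn_Ici 0) 0 self_mem_Ici)
    have h1 := hstrict.hasFDerivAt.hasFDerivWithinAt (s := {p : State N × ℝ | 0 ≤ p.2})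
    have h2 := hW.hasFDerivAt.hasFDerivWithinAt (s := {p : State N × ℝ | 0 ≤ p.2})
    have h3 := h2.congr_of_eventuallyEq (f₁ := fun p : State N × ℝ => S.E k p.1 p.2) (by
      filter_upwards [hEW.filter_mono nhdsWithin_le_nhds, self_mem_nhdsWithin] with p hp hp'
      exact hp hp') (by rw [h0]; exact hE0)
    rw [huniq.eq h1 h3] at hstrict
    exact hstrict
  · have hst : ∀ᶠ p : State N × ℝ in 𝓝 (u₀, 0), p.1 ∈ S.states :=
      continuous_fst.continuousAt.eventually_mem (S.isOpen_states.mem_nhds hu₀)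
    filter_upwards [hev, hEW, S.shockDom_near k hk u₀ hu₀, hst] with p h1 h2 h3 h4
    rcases le_or_gt 0 p.2 with h | h
    · exact Or.inl ⟨Or.inr h, by rw [h2 h]; exact h1⟩
    · exact Or.inr ⟨hk, h4, h3 h, rfl⟩

/-- The eigenvectors span the space. -/
theorem exists_sum_smul_r {u : State N} (hu : u ∈ S.states) (v : State N) :
    ∃ z : Fin N → ℝ, ∑ k, z k • S.r k u = v := by
  -- The `r_k` are eigenvectors of `(Dq)⁻¹ Df` for distinct eigenvalues, hence independent, and
  -- there are `N` of them.
  let e := LinearEquiv.ofInjectiveEndo (fderiv ℝ S.q u : State N →ₗ[ℝ] State N)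
    (S.injective_fderiv_q u hu)
  let A : Module.End ℝ (State N) := e.symm.toLinearMap ∘ₗ (fderiv ℝ S.f u : State N →ₗ[ℝ] State N)
  have hinj : Function.Injective fun k => S.lam k u := by
    intro i k h
    rcases lt_trichotomy i k with hik | hik | hik
    · exact absurd h (S.strictly_hyperbolic i k hik u hu).ne
    · exact hik
    · exact absurd h (S.strictly_hyperbolic k i hik u hu).ne'
  have hli := Module.End.eigenvectors_linearIndependent' A (fun k => S.lam k u) hinj
    (fun k => S.r k u) fun k => by
      refine ⟨Module.End.mem_eigenspace_iff.2 ?_, S.r_ne_zero k u hu⟩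
      change e.symm (fderiv ℝ S.f u (S.r k u)) = _
      rw [S.eigen k u hu, map_smul]
      congr 1
      exact e.symm_apply_apply (S.r k u)
  have hspan := hli.span_eq_top_of_card_eq_finrank' (by simp)
  exact (Submodule.mem_span_range_iff_exists_fun ℝ).1 (hspan ▸ Submodule.mem_top)

/-- Generalized Riemann problems with nearby data have solutions with weak waves. -/
theorem eventually_exists_chain {u₀ : State N} (hu₀ : u₀ ∈ S.states) (p : Fin N → Prop) {η : ℝ}
    (hη : 0 < η) : ∀ᶠ x : State N × State N in 𝓝 (u₀, u₀),
      ∃ (ζ : Fin N → ℝ) (u : Fin (N + 1) → State N), u 0 = x.1 ∧ u (Fin.last N) = x.2 ∧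
        (∀ k : Fin N, (¬ p k → S.Elementary k (u k.castSucc) (ζ k) (u k.succ)) ∧
          (p k → S.SimpleWave k (u k.castSucc) (ζ k) (u k.succ))) ∧ ∀ k, |ζ k| < η := by
  have hG : ∀ k, ∃ G : State N × ℝ → State N, G (u₀, 0) = u₀ ∧
      HasStrictFDerivAt G (ContinuousLinearMap.fst ℝ (State N) ℝ +
        (ContinuousLinearMap.snd ℝ (State N) ℝ).smulRight (S.r k u₀)) (u₀, 0) ∧
      ∀ᶠ x : State N × ℝ in 𝓝 (u₀, 0), (¬ p k → S.Elementary k x.1 x.2 (G x)) ∧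
        (p k → S.SimpleWave k x.1 x.2 (G x)) := by
    intro k
    by_cases hk : p k
    · obtain ⟨G, h1, h2, h3⟩ := S.exists_simpleWave_map k hu₀
      exact ⟨G, h1, h2, h3.mono fun x hx => ⟨fun h => absurd hk h, fun _ => hx⟩⟩
    · obtain ⟨G, h1, h2, h3⟩ := S.exists_elementary_map k hu₀
      exact ⟨G, h1, h2, h3.mono fun x hx => ⟨fun _ => hx, fun h => absurd h hk⟩⟩
  choose G hG0 hGd hGe using hG
  -- The state reached from `x.1` after the first `j` waves with strengths `x.2`. At `(u₀, 0)` its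
  -- derivative is `(a, z) ↦ a + ∑ z_k r_k`, summed over these waves.
  let Φ : Fin (N + 1) → State N × (Fin N → ℝ) → State N := fun j x =>
    Fin.induction (motive := fun _ => State N) x.1 (fun k s => G k (s, x.2 k)) j
  have hΦ0 : ∀ x, Φ 0 x = x.1 := fun x => rfl
  have hΦs : ∀ k x, Φ k.succ x = G k (Φ k.castSucc x, x.2 k) := fun k x =>
    Fin.induction_succ _ _ _
  have hΦu : ∀ j, Φ j (u₀, 0) = u₀ := by
    intro j
    induction j using Fin.induction with
    | zero => rfl
    | succ k ih => rw [hΦs, ih]; exact hG0 k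
  have hΦd : ∀ j, ∃ D : State N × (Fin N → ℝ) →L[ℝ] State N,
      HasStrictFDerivAt (Φ j) D (u₀, 0) ∧
        ∀ x, D x = x.1 + ∑ k with k.castSucc < j, x.2 k • S.r k u₀ := by
    intro j
    induction j using Fin.induction with
    | zero =>
      refine ⟨ContinuousLinearMap.fst ℝ _ _, hasStrictFDerivAt_fst, fun x => ?_⟩
      simp
    | succ k ih =>
      obtain ⟨D, hD, hDx⟩ := ih
      have hz : HasStrictFDerivAt (fun x : State N × (Fin N → ℝ) => x.2 k)
          ((ContinuousLinearMap.proj (R := ℝ) (φ := fun _ : Fin N => ℝ) k).comp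
            (ContinuousLinearMap.snd ℝ _ _)) (u₀, 0) :=
        ((ContinuousLinearMap.proj (R := ℝ) (φ := fun _ : Fin N => ℝ) k).comp
            (ContinuousLinearMap.snd ℝ (State N) _)).hasStrictFDerivAt
      have hpair := hD.prodMk hz
      have hk := hGd k
      rw [← hΦu k.castSucc] at hk
      have hcomp := HasStrictFDerivAt.comp (u₀, (0 : Fin N → ℝ)) (g := G k)
        (f := fun x => (Φ k.castSucc x, x.2 k)) hk hpair
      refine ⟨_, hcomp, fun x => ?_⟩
      have hfil : (Finset.univ.filter fun i : Fin N => i.castSucc < k.succ) =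
          insert k (Finset.univ.filter fun i : Fin N => i.castSucc < k.castSucc) := by
        ext i
        simp [Fin.castSucc_lt_succ_iff, le_iff_eq_or_lt]
      rw [hfil, Finset.sum_insert (by simp)]
      simp only [ContinuousLinearMap.comp_apply, ContinuousLinearMap.prod_apply,
        add_apply, ContinuousLinearMap.coe_fst', hDx,
        ContinuousLinearMap.smulRight_apply, ContinuousLinearMap.coe_snd',
        ContinuousLinearMap.proj_apply, hΦu]
      abel
  obtain ⟨D, hD, hDx⟩ := hΦd (Fin.last N)
  -- Surjectivity makes the map from left state and strengths to both outer states open at `(u₀,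
  -- 0)`. Only existence of a weak solution is extracted here.
  have hsurj : (ContinuousLinearMap.prod (ContinuousLinearMap.fst ℝ _ _) D).range = ⊤ := by
    rw [LinearMap.range_eq_top]
    rintro ⟨a, b⟩
    obtain ⟨z, hz⟩ := S.exists_sum_smul_r hu₀ (b - a)
    refine ⟨(a, z), ?_⟩
    have : D (a, z) = b := by
      rw [hDx, Finset.filter_true_of_mem fun k _ => Fin.castSucc_lt_last k, hz]
      abel
    exact Prod.ext rfl this
  have hmap := ((hasStrictFDerivAt_fst (𝕜 := ℝ) (p := (u₀, (0 : Fin N → ℝ)))).prodMk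
    hD).map_nhds_eq_of_surj hsurj
  simp only [hΦu] at hmap
  have hgood : ∀ᶠ x : State N × (Fin N → ℝ) in 𝓝 (u₀, 0), ∀ k,
      ((¬ p k → S.Elementary k (Φ k.castSucc x) (x.2 k) (Φ k.succ x)) ∧
        (p k → S.SimpleWave k (Φ k.castSucc x) (x.2 k) (Φ k.succ x))) ∧ |x.2 k| < η := by
    refine eventually_all.2 fun k => ?_
    obtain ⟨D', hD', -⟩ := hΦd k.castSucc
    have hc : ContinuousAt (fun x : State N × (Fin N → ℝ) => (Φ k.castSucc x, x.2 k))
        (u₀, 0) := hD'.continuousAt.prodMk (by fun_prop)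
    have ht := hc.tendsto
    simp only [hΦu] at ht
    have hη' : ∀ᶠ x : State N × (Fin N → ℝ) in 𝓝 (u₀, 0), |x.2 k| < η := by
      have : ContinuousAt (fun x : State N × (Fin N → ℝ) => |x.2 k|) (u₀, 0) := by fun_prop
      exact this.eventually_lt continuousAt_const (by simpa using hη)
    filter_upwards [ht.eventually (hGe k), hη'] with x h1 h2
    rw [hΦs]
    exact ⟨h1, h2⟩
  rw [← hmap]
  exact hgood.mono fun x hx => ⟨x.2, fun j => Φ j x, hΦ0 x, rfl, fun k => (hx k).1,
    fun k => (hx k).2⟩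

/-- In a compact set of states, the waves in the solution of a generalized Riemann problem are weak
if the data are close to each other. -/
theorem exists_forall_chain_lt (hS : S.GRPSolvable) {K : Set (State N)} (hK : IsCompact K)
    (hKS : K ⊆ S.states) {η : ℝ} (hη : 0 < η) : ∃ d > 0, ∀ a ∈ K, ∀ b, ‖b - a‖ < d →
      b ∈ S.states ∧ ∀ w, S.Widths w → ∀ (ζ : Fin N → ℝ) (u : Fin (N + 1) → State N),
        u 0 = a → u (Fin.last N) = b → S.Chain w ζ u → ∀ k, |ζ k| < η := by
  classical
  have hloc : ∀ u₀ ∈ S.states, ∀ᶠ x : State N × State N in 𝓝 (u₀, u₀),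
      x.2 ∈ S.states ∧ ∀ w, S.Widths w → ∀ (ζ : Fin N → ℝ) (u : Fin (N + 1) → State N),
        u 0 = x.1 → u (Fin.last N) = x.2 → S.Chain w ζ u → ∀ k, |ζ k| < η := by
    intro u₀ hu₀
    have h1 : ∀ᶠ x : State N × State N in 𝓝 (u₀, u₀), x.1 ∈ S.states ∧ x.2 ∈ S.states :=
      prod_mem_nhds (S.isOpen_states.mem_nhds hu₀) (S.isOpen_states.mem_nhds hu₀)
    -- The widths matter only through the set of families with `w k > 0`. There are finitely many
    -- such sets, so one neighbourhood serves all widths. Global uniqueness then identifies any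
    -- given solution with the weak one.
    have h2 := eventually_all.2 fun p : Fin N → Prop => S.eventually_exists_chain hu₀ p hη
    filter_upwards [h1, h2] with x hx hex
    refine ⟨hx.2, fun w hw ζ u h0 hl hc => ?_⟩
    obtain ⟨ζ', u', h0', hl', hc', hlt⟩ := hex fun k => 0 < w k
    have := (hS w hw x.1 hx.1 x.2 hx.2).unique ⟨u, h0, hl, hc⟩ ⟨u', h0', hl', fun k =>
      ⟨fun hk => (hc' k).1 (by simp [hk]), (hc' k).2⟩⟩
    rw [this]
    exact hlt
  choose! ρ hρ hball using fun u₀ hu₀ => Metric.eventually_nhds_iff_ball.1 (hloc u₀ hu₀)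
  obtain ⟨d, hd, hleb⟩ := lebesgue_number_lemma_of_metric hK (ι := S.states)
    (c := fun u : S.states => Metric.ball (u : State N) (ρ u)) (fun _ => Metric.isOpen_ball)
    (fun u hu => mem_iUnion.2 ⟨⟨u, hKS hu⟩, Metric.mem_ball_self (hρ u (hKS hu))⟩)
  refine ⟨d, hd, fun a ha b hab => ?_⟩
  obtain ⟨⟨u₀, hu₀⟩, hsub⟩ := hleb a ha
  have h1 := hsub (Metric.mem_ball_self hd)
  have h2 := hsub (by rwa [Metric.mem_ball, dist_eq_norm] : b ∈ Metric.ball a d)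
  refine hball u₀ hu₀ (a, b) ?_
  rw [Metric.mem_ball, Prod.dist_eq]
  exact max_lt h1 h2

end HyperbolicSystem

/-! ## The waves that emerge from an interaction -/

section linked

variable {N : ℕ}

theorem linked_append {a b : State N} {l l' : List (Wave N)} :
    Linked a (l ++ l') b ↔ ∃ c, Linked a l c ∧ Linked c l' b := by
  induction l generalizing a with
  | nil => simp [Linked]
  | cons γ l ih => simp [Linked, ih, and_assoc]

theorem Linked.eq_add_sum {a b : State N} {l : List (Wave N)} (h : Linked a l b) :
    b = a + (l.map fun γ => γ.right - γ.left).sum := by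
  induction l generalizing a with
  | nil => simpa [Linked] using Eq.symm h
  | cons γ l ih =>
    obtain ⟨rfl, h⟩ := h
    rw [ih h, List.map_cons, List.sum_cons]
    abel

/-- Lists that join consecutive states can be concatenated. -/
theorem joins_flatten {α : Type*} {R : State N → List α → State N → Prop}
    (hnil : ∀ a, R a [] a) (happ : ∀ a b c l l', R a l b → R b l' c → R a (l ++ l') c) {n : ℕ}
    {fam : Fin n → List α} {u : Fin (n + 1) → State N}
    (h : ∀ k, R (u k.castSucc) (fam k) (u k.succ)) :
    R (u 0) (List.ofFn fam).flatten (u (Fin.last n)) := by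
  induction n with
  | zero => simpa using hnil (u 0)
  | succ n ih =>
    rw [List.ofFn_succ, List.flatten_cons]
    exact happ _ _ _ _ _ (h 0) (ih (fam := fun k => fam k.succ) (u := fun k => u k.succ)
      fun k => h k.succ)

end linked

namespace HyperbolicSystem

variable {N : ℕ} (S : HyperbolicSystem N)

/-- A wave in the solution of a generalized Riemann problem with the widths `w`. -/
def Realizes (w : Fin N → ℝ) (γ : Wave N) : Prop :=
  (w γ.family = 0 → S.Elementary γ.family γ.left γ.strength γ.right) ∧
    (0 < w γ.family → S.SimpleWave γ.family γ.left γ.strength γ.right)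

variable {S}

theorem SimpleWave.right_mem {k : Fin N} {a b : State N} {ζ : ℝ} (h : S.SimpleWave k a ζ b) :
    b ∈ S.states := by
  obtain ⟨c, -, rfl, hc⟩ := h
  exact (hc ζ right_mem_uIcc).1

theorem SimpleWave.eq_of_zero {k : Fin N} {a b : State N} (h : S.SimpleWave k a 0 b) : a = b := by
  obtain ⟨c, rfl, rfl, -⟩ := h
  rfl

theorem Elementary.right_mem {k : Fin N} {a b : State N} {ζ : ℝ} (h : S.Elementary k a ζ b) :
    b ∈ S.states := by
  rcases h with ⟨-, h⟩ | ⟨hk, ha, hζ, rfl⟩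
  · exact SimpleWave.right_mem h
  · obtain ⟨σ, hσ⟩ := (S.E_shock k hk a ha).mapsTo hζ
    exact hσ.2.1

theorem Elementary.eq_of_zero {k : Fin N} {a b : State N} (h : S.Elementary k a 0 b) : a = b := by
  rcases h with ⟨-, h⟩ | ⟨-, -, hζ, -⟩
  · exact SimpleWave.eq_of_zero h
  · exact absurd (S.shockDom_neg k a 0 hζ) (lt_irrefl _)

theorem Realizes.right_mem {w : Fin N → ℝ} (hw : S.Widths w) {γ : Wave N} (h : S.Realizes w γ) :
    γ.right ∈ S.states := by
  rcases (hw γ.family).1.eq_or_lt with h0 | h0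
  · exact Elementary.right_mem (h.1 h0.symm)
  · exact SimpleWave.right_mem (h.2 h0)

/-- By `hp` the filter keeps an initial segment of the list, so the sum telescopes to the right
state of its last wave. -/
theorem sum_filter_family_mem {w : Fin N → ℝ} (hw : S.Widths w) {l : List (Wave N)} {a b : State N}
    (ha : a ∈ S.states) (hl : Linked a l b) (hr : ∀ γ ∈ l, S.Realizes w γ) (p : Wave N → Bool)
    (hp : l.Pairwise fun γ γ' => p γ' → p γ) :
    a + ((l.filter p).map fun γ => γ.right - γ.left).sum ∈ S.states := by
  induction l generalizing a with
  | nil => simpa using ha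
  | cons γ l ih =>
    obtain ⟨rfl, hl⟩ := hl
    rw [List.pairwise_cons] at hp
    by_cases hγ : p γ
    · rw [List.filter_cons_of_pos hγ, List.map_cons, List.sum_cons, ← add_assoc,
        add_sub_cancel]
      exact ih (Realizes.right_mem hw (hr γ (by simp))) hl (fun γ hγ => hr γ (by simp [hγ])) hp.2
    · have : (γ :: l).filter p = [] := by
        refine List.filter_eq_nil_iff.2 fun γ' hγ' => ?_
        rcases List.mem_cons.1 hγ' with rfl | hγ'
        · exact hγ
        · exact fun h => hγ (hp.1 γ' hγ' h)
      simpa [this] using ha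

/-- Waves of increasing families, each of which joins its left to its right state, form the
solution of a generalized Riemann problem. -/
theorem exists_chain_of_linked {w : Fin N → ℝ} (hw : S.Widths w) {l : List (Wave N)}
    {a b : State N} (ha : a ∈ S.states) (hl : Linked a l b) (hr : ∀ γ ∈ l, S.Realizes w γ)
    (hfam : l.Pairwise fun γ γ' => γ.family < γ'.family) :
    ∃ (ζ : Fin N → ℝ) (u : Fin (N + 1) → State N), u 0 = a ∧ u (Fin.last N) = b ∧
      S.Chain w ζ u ∧ ∀ γ ∈ l, ζ γ.family = γ.strength := by
  -- The state behind all waves of families below `j`. The sum in `ζ` has at most one term, because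
  -- families strictly increase along the list.
  let u : Fin (N + 1) → State N := fun j =>
    a + ((l.filter fun γ => γ.family.castSucc < j).map fun γ => γ.right - γ.left).sum
  let ζ : Fin N → ℝ := fun k =>
    ((l.filter fun γ => γ.family = k).map Wave.strength).sum
  have hu : ∀ j, u j ∈ S.states := fun j => sum_filter_family_mem hw ha hl hr _
    (hfam.imp fun h h' => by
      simp only [decide_eq_true_eq] at h' ⊢
      exact (Fin.castSucc_lt_castSucc_iff.2 h).trans h')
  have key : ∀ γ ∈ l, u γ.family.castSucc = γ.left ∧ u γ.family.succ = γ.right ∧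
      ζ γ.family = γ.strength := by
    intro γ hγ
    obtain ⟨l₁, l₂, rfl⟩ := List.append_of_mem hγ
    obtain ⟨-, h2, h1⟩ := List.pairwise_append.1 hfam
    have h2 := (List.pairwise_cons.1 h2).1
    have h1 : ∀ γ' ∈ l₁, γ'.family < γ.family := fun γ' h => h1 γ' h γ (by simp)
    obtain ⟨c, hc, hc', -⟩ := linked_append.1 hl
    rw [hc.eq_add_sum] at hc'
    have e1 : (l₁ ++ γ :: l₂).filter (fun γ' => γ'.family.castSucc < γ.family.castSucc) = l₁ := by
      rw [List.filter_append, List.filter_eq_self.2, List.filter_eq_nil_iff.2, List.append_nil]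
      · intro γ' hγ'
        rcases List.mem_cons.1 hγ' with rfl | hγ'
        · simp
        · simpa using (h2 γ' hγ').le
      · intro γ' hγ'
        simpa using h1 γ' hγ'
    have e2 : (l₁ ++ γ :: l₂).filter (fun γ' => γ'.family.castSucc < γ.family.succ) =
        l₁ ++ [γ] := by
      have : l₁ ++ γ :: l₂ = (l₁ ++ [γ]) ++ l₂ := by simp
      rw [this, List.filter_append, List.filter_eq_self.2, List.filter_eq_nil_iff.2,
        List.append_nil]
      · intro γ' hγ'
        simpa [Fin.castSucc_lt_succ_iff] using h2 γ' hγ'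
      · intro γ' hγ'
        rcases List.mem_append.1 hγ' with hγ' | hγ'
        · simpa [Fin.castSucc_lt_succ_iff] using (h1 γ' hγ').le
        · rw [List.mem_singleton.1 hγ']
          simp
    have e3 : (l₁ ++ γ :: l₂).filter (fun γ' => γ'.family = γ.family) = [γ] := by
      rw [List.filter_append, List.filter_eq_nil_iff.2, List.nil_append,
        List.filter_cons_of_pos (by simp), List.filter_eq_nil_iff.2]
      · intro γ' hγ'
        simpa using (h2 γ' hγ').ne'
      · intro γ' hγ'
        simpa using (h1 γ' hγ').ne
    refine ⟨?_, ?_, ?_⟩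
    · simp only [u]
      rw [e1, hc']
    · simp only [u]
      rw [e2, List.map_append, List.sum_append, ← add_assoc, ← hc']
      simp
    · simp only [ζ]
      rw [e3]
      simp
  refine ⟨ζ, u, ?_, ?_, fun k => ?_, fun γ hγ => (key γ hγ).2.2⟩
  · have : l.filter (fun γ => γ.family.castSucc < 0) = [] :=
      List.filter_eq_nil_iff.2 fun γ _ => by simp
    simp only [u]
    rw [this]
    simp
  · have : l.filter (fun γ => γ.family.castSucc < Fin.last N) = l :=
      List.filter_eq_self.2 fun γ _ => by simp
    simp only [u]
    rw [this, hl.eq_add_sum]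
  -- A family without a wave in the list gets the trivial wave of strength `0`.
  · by_cases hk : ∃ γ ∈ l, γ.family = k
    · obtain ⟨γ, hγ, rfl⟩ := hk
      obtain ⟨h1, h2, h3⟩ := key γ hγ
      rw [h1, h2, h3]
      exact hr γ hγ
    · push Not at hk
      have e1 : u k.succ = u k.castSucc := by
        simp only [u]
        congr 3
        refine List.filter_congr fun γ hγ => ?_
        have : γ.family.castSucc < k.succ ↔ γ.family.castSucc < k.castSucc := by
          rw [Fin.castSucc_lt_succ_iff, Fin.castSucc_lt_castSucc_iff, (hk γ hγ).le_iff_lt]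
        simp only [this]
      have e2 : ζ k = 0 := by
        have : l.filter (fun γ => γ.family = k) = [] :=
          List.filter_eq_nil_iff.2 fun γ hγ => by simpa using hk γ hγ
        simp only [ζ]
        rw [this]
        simp
      rw [e1, e2]
      have := S.simpleWave_zero (k := k) (hu k.castSucc)
      exact ⟨fun _ => Or.inl ⟨Or.inr le_rfl, this⟩, fun _ => this⟩

end HyperbolicSystem

namespace MFTParams

theorem rare_pos (P : MFTParams) : 0 < P.rare := Real.rpow_pos_of_pos P.ε_pos _

theorem pass_pos (P : MFTParams) : 0 < P.pass := Real.rpow_pos_of_pos P.ε_pos _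

theorem pass_lt_rare (P : MFTParams) : P.pass < P.rare := by
  refine lt_of_lt_of_le P.passenger_lt_split ?_
  exact mul_le_of_le_one_left P.rare_pos.le (by linarith [P.κ_lt])

end MFTParams

/-! ### Strengths and families of emerging waves -/

section emerging

variable {N : ℕ} {S : HyperbolicSystem N} {P : MFTParams}

theorem FamilySeeds.linked {t : ℝ} {k : Fin N} {w ζ : ℝ} {a b : State N} {l : List (Seed N)}
    (h : FamilySeeds S P t k w a ζ b l) (h0 : ζ = 0 → a = b) : Linked a (l.map Seed.wave) b := by
  rcases h with ⟨hζ, rfl⟩ | ⟨-, -, γ, -, -, rfl, rfl, -, rfl⟩ | ⟨-, -, -, h, -⟩ | ⟨-, -, -, h, -⟩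
  · exact h0 hζ
  · simp [Linked]
  · exact h.1
  · exact h.1

theorem FamilySeeds.realizes {t : ℝ} {k : Fin N} {w : Fin N → ℝ} {ζ : ℝ} {a b : State N}
    {l : List (Seed N)} (h : FamilySeeds S P t k (w k) a ζ b l)
    (hc : (w k = 0 → S.Elementary k a ζ b) ∧ (0 < w k → S.SimpleWave k a ζ b)) :
    ∀ s ∈ l, s.wave.family = k ∧ S.Realizes w s.wave := by
  have hsplit : IsSplitRarefaction S P k a ζ b (l.map Seed.wave) →
      ∀ s ∈ l, s.wave.family = k ∧ S.Realizes w s.wave := by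
    intro h s hs
    obtain ⟨h1, -, h2, h3, -⟩ := h.2.2 s.wave (List.mem_map_of_mem hs)
    refine ⟨h1, ?_⟩
    unfold HyperbolicSystem.Realizes
    rw [h1]
    exact ⟨fun _ => Or.inl ⟨Or.inr ((mul_pos P.κ_pos P.rare_pos).le.trans h3), h2⟩, fun _ => h2⟩
  rcases h with ⟨-, rfl⟩ | ⟨-, -, γ, rfl, rfl, rfl, rfl, -, rfl⟩ | ⟨-, -, -, h, -⟩ | ⟨-, -, -, h, -⟩
  · simp
  · simpa [HyperbolicSystem.Realizes] using hc
  · exact hsplit h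
  · exact hsplit h

theorem FamilySeeds.lt_of_multi {t : ℝ} {k : Fin N} {w ζ : ℝ} {a b : State N} {l : List (Seed N)}
    (h : FamilySeeds S P t k w a ζ b l) : ∀ s ∈ l, ∀ p ∈ s.multi, t < p.1 := by
  rcases h with ⟨-, rfl⟩ | ⟨-, -, γ, -, -, -, -, -, rfl⟩ | ⟨-, -, -, -, h⟩ |
    ⟨-, -, -, -, m, -, -, -, ubar, -, tSharp, h, -, h'⟩
  · simp
  · simp
  · intro s hs p hp
    simp [(h s hs).2] at hp
  · intro s hs p hp
    rw [(h' s hs).2, Option.mem_some_iff] at hp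
    rw [← hp]
    exact h

/-- Two waves of one family arise only from a split rarefaction. Its pieces have strength at least
`κ ε^{e_r} > ε^{e_p}`, too much for a passenger. -/
theorem FamilySeeds.pairwise {t : ℝ} {k : Fin N} {w ζ : ℝ} {a b : State N} {l : List (Seed N)}
    (h : FamilySeeds S P t k w a ζ b l) :
    l.Pairwise fun s s' => P.pass < |s.wave.strength| ∧ P.pass < |s'.wave.strength| := by
  have hsplit : IsSplitRarefaction S P k a ζ b (l.map Seed.wave) →
      l.Pairwise fun s s' => P.pass < |s.wave.strength| ∧ P.pass < |s'.wave.strength| := by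
    intro h
    have hs : ∀ s ∈ l, P.pass < |s.wave.strength| := fun s hs =>
      P.passenger_lt_split.trans_le
        ((h.2.2 s.wave (List.mem_map_of_mem hs)).2.2.2.1.trans (le_abs_self _))
    exact List.pairwise_of_forall_mem_list fun s h1 s' h2 => ⟨hs s h1, hs s' h2⟩
  rcases h with ⟨-, rfl⟩ | ⟨-, -, γ, -, -, -, -, -, rfl⟩ | ⟨-, -, -, h, -⟩ | ⟨-, -, -, h, -⟩
  · simp
  · simp
  · exact hsplit h
  · exact hsplit h

/-- A wave below `ε^{e_p} < ε^{e_r}` is never split. -/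
theorem FamilySeeds.lt_pass {t : ℝ} {k : Fin N} {w ζ : ℝ} {a b : State N} {l : List (Seed N)}
    (h : FamilySeeds S P t k w a ζ b l) (hζ : |ζ| < P.pass) :
    ∀ s ∈ l, |s.wave.strength| < P.pass := by
  have := P.pass_lt_rare
  have := le_abs_self ζ
  rcases h with ⟨-, rfl⟩ | ⟨-, -, γ, rfl, -, -, -, -, rfl⟩ | ⟨-, -, h, -⟩ | ⟨-, -, h, -⟩
  · simp
  · simpa using hζ
  · linarith
  · linarith

/-- The properties of the waves that emerge from a point at time `t`. -/
structure EmergingSeeds (S : HyperbolicSystem N) (P : MFTParams) (w : Fin N → ℝ)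
    (uL uR : State N) (t : ℝ) (l : List (Seed N)) : Prop where
  linked : Linked uL (l.map Seed.wave) uR
  realizes : ∀ s ∈ l, S.Realizes w s.wave
  lt_of_multi : ∀ s ∈ l, ∀ p ∈ s.multi, t < p.1
  pairwise : l.Pairwise fun s s' => s.wave.family < s'.wave.family ∨
    P.pass < |s.wave.strength| ∧ P.pass < |s'.wave.strength|
  lt_pass : (∀ (ζ : Fin N → ℝ) (u : Fin (N + 1) → State N), u 0 = uL → u (Fin.last N) = uR →
    S.Chain w ζ u → ∀ k, |ζ k| < P.pass) → ∀ s ∈ l, |s.wave.strength| < P.pass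

theorem Resolves.emergingSeeds {w : Fin N → ℝ} (hw : S.Widths w) {uL uR : State N} {t : ℝ}
    {l : List (Seed N)} (h : Resolves S P w uL uR t l) : EmergingSeeds S P w uL uR t l := by
  obtain ⟨ζ, u, fam, rfl, rfl, hc, -, hfam, rfl⟩ := h
  have hzero : ∀ k, ζ k = 0 → u k.castSucc = u k.succ := by
    intro k hk
    have := hc k
    rw [hk] at this
    rcases (hw k).1.eq_or_lt with h0 | h0
    · exact HyperbolicSystem.Elementary.eq_of_zero (this.1 h0.symm)
    · exact HyperbolicSystem.SimpleWave.eq_of_zero (this.2 h0)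
  have hmem : ∀ s ∈ (List.ofFn fam).flatten, ∃ k, s ∈ fam k := by
    intro s hs
    obtain ⟨l, hl, hs⟩ := List.mem_flatten.1 hs
    obtain ⟨k, rfl⟩ := List.mem_ofFn.1 hl
    exact ⟨k, hs⟩
  have hreal := fun k => (hfam k).realizes (hc k)
  constructor
  · refine joins_flatten (R := fun a l b => Linked a (l.map Seed.wave) b) (fun a => rfl) ?_
      fun k => (hfam k).linked (hzero k)
    intro a b c l l' h h'
    rw [List.map_append]
    exact linked_append.2 ⟨b, h, h'⟩
  · intro s hs
    obtain ⟨k, hk⟩ := hmem s hs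
    exact (hreal k s hk).2
  · intro s hs
    obtain ⟨k, hk⟩ := hmem s hs
    exact (hfam k).lt_of_multi s hk
  · refine List.pairwise_flatten.2 ⟨fun l hl => ?_, ?_⟩
    · obtain ⟨k, rfl⟩ := List.mem_ofFn.1 hl
      exact (hfam k).pairwise.imp fun h => Or.inr h
    · refine List.pairwise_ofFn.2 fun i k hik s hs s' hs' => Or.inl ?_
      rwa [(hreal i s hs).1, (hreal k s' hs').1]
  · intro h s hs
    obtain ⟨k, hk⟩ := hmem s hs
    exact (hfam k).lt_pass (h ζ u rfl rfl hc k) s hk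

/-- A carrier that is not a lonely weak wave and its passengers have different families. -/
theorem Cluster.pairwise_family {w : Fin N → ℝ} {uL uR : State N} {t : ℝ} {G : Cluster N}
    {l₁ l₂ : List (Seed N)} (h : EmergingSeeds S P w uL uR t (l₁ ++ G.seeds ++ l₂))
    (hG : ∀ s ∈ G.passengers, |s.wave.strength| < P.pass) :
    (G.seeds.map Seed.wave).Pairwise fun γ γ' => γ.family < γ'.family := by
  rw [List.pairwise_map]
  have h1 := (List.pairwise_append.1 (List.pairwise_append.1 h.pairwise).1).2.1
  unfold Cluster.seeds at h1 ⊢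
  have hpre : ∀ s ∈ G.pre, |s.wave.strength| < P.pass := fun s hs =>
    hG s (List.mem_append_left _ hs)
  have hpost : ∀ s ∈ G.post, |s.wave.strength| < P.pass := fun s hs =>
    hG s (List.mem_append_right _ hs)
  rw [List.pairwise_append, List.pairwise_cons] at h1 ⊢
  obtain ⟨k1, ⟨k2, k3⟩, k4⟩ := h1
  -- Among any two waves of the cluster at least one is a passenger, which rules out the alternative
  -- that both exceed `ε^{e_p}`.
  refine ⟨k1.imp_of_mem fun {s s'} hs _ h => ?_, ⟨fun s hs => ?_, k3.imp_of_mem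
    fun {s s'} hs _ h => ?_⟩, fun s hs s' hs' => ?_⟩
  · exact h.resolve_right fun h => absurd h.1 (hpre s hs).not_gt
  · exact (k2 s hs).resolve_right fun h => absurd h.2 (hpost s hs).not_gt
  · exact h.resolve_right fun h => absurd h.1 (hpost s hs).not_gt
  · exact (k4 s hs s' hs').resolve_right fun h => absurd h.1 (hpre s hs).not_gt

end emerging

/-! ## Wave sequences as lists of jumps -/

namespace Front

variable {N : ℕ}

/-- The state to the left of the front. -/
def leftState (F : Front N) : State N := (F.waves.head?.map Wave.left).getD 0

/-- The jump discontinuity that is represented by the front. -/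
noncomputable def toJump (F : Front N) : Jump N where
  start := F.x0 - F.speed * F.t0
  speed := F.speed
  left := F.leftState
  height := (F.waves.map fun γ => γ.right - γ.left).sum
  due := F.pending.map Prod.fst

@[simp] theorem toJump_pos (F : Front N) (t : ℝ) : F.toJump.pos t = F.pos t := by
  simp only [toJump, Jump.pos, pos]; ring

@[simp] theorem toJump_speed (F : Front N) : F.toJump.speed = F.speed := rfl

/-- The default value `0` of `leftState` plays no role, since every front that occurs carries at
least one wave. -/
theorem leftState_eq {F : Front N} {a b : State N} (h : Linked a F.waves b) (hF : F.waves ≠ []) :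
    F.leftState = a := by
  obtain ⟨γ, l, hl⟩ := List.exists_cons_of_ne_nil hF
  rw [hl] at h
  simp [leftState, hl, h.1]

end Front

/-! ### Translation of fronts and their interactions into jumps and emissions -/

section fronts

variable {N : ℕ} {S : HyperbolicSystem N} {P : MFTParams}

theorem adjoined_map_toJump {Γ : List (Front N)} (hΓ : ∀ F ∈ Γ, F.waves ≠ []) {a b : State N}
    (h : Linked a (Γ.flatMap Front.waves) b) :
    Adjoined a (Γ.map Front.toJump) ∧ a + totalHeight (Γ.map Front.toJump) = b := by
  induction Γ generalizing a with
  | nil => simpa [Adjoined, Linked] using h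
  | cons F Γ ih =>
    rw [List.flatMap_cons, linked_append] at h
    obtain ⟨c, h1, h2⟩ := h
    obtain ⟨h3, h4⟩ := ih (fun G hG => hΓ G (by simp [hG])) h2
    have h5 : F.toJump.left = a := F.leftState_eq h1 (hΓ F (by simp))
    have h6 : a + F.toJump.height = c := h1.eq_add_sum.symm
    have h7 : F.toJump.right = c := by rw [Jump.right, h5, h6]
    refine ⟨⟨h5, by rwa [h7]⟩, ?_⟩
    rw [List.map_cons, totalHeight_cons, ← add_assoc, h6, h4]

theorem Cluster.Launches.waves_ne_nil {x t : ℝ} {G : Cluster N} {F : Front N}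
    (h : G.Launches S P x t F) : F.waves ≠ [] := by
  rw [h.1]; simp [Cluster.seeds]

theorem Cluster.Launches.pos_eq {x t : ℝ} {G : Cluster N} {F : Front N}
    (h : G.Launches S P x t F) : F.pos t = x := by
  simp [Front.pos, h.2.2.1, h.2.2.2.1]

theorem Cluster.Launches.lt_of_pending {x t : ℝ} {G : Cluster N} {F : Front N}
    (h : G.Launches S P x t F) (hG : ∀ p ∈ G.carrier.multi, t < p.1) :
    ∀ p ∈ F.pending, t < p.1 := by
  obtain ⟨-, -, -, -, -, s, -, h⟩ := h
  rcases hm : G.carrier.multi with _ | ⟨tSharp, l⟩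
  · rw [hm] at h
    simp [h.2.2]
  · rw [hm] at h
    simp only [h.2.2, Option.mem_some_iff]
    rintro p rfl
    exact hG (tSharp, l) hm

theorem flatMap_waves_of_launches {x t : ℝ} {gs : List (Cluster N)} {O : List (Front N)}
    (h : List.Forall₂ (Cluster.Launches S P x t) gs O) :
    O.flatMap Front.waves = (gs.flatMap Cluster.seeds).map Seed.wave := by
  induction h with
  | nil => rfl
  | cons h _ ih => simp [h.1, ih]

theorem exists_of_forall₂_right {α β : Type*} {R : α → β → Prop} {l : List α} {l' : List β}
    (h : List.Forall₂ R l l') : ∀ b ∈ l', ∃ a ∈ l, R a b := by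
  induction h with
  | nil => simp
  | cons h _ ih =>
    intro b hb
    rcases List.mem_cons.1 hb with rfl | hb
    · exact ⟨_, by simp, h⟩
    · obtain ⟨a, ha, hab⟩ := ih b hb
      exact ⟨a, by simp [ha], hab⟩

/-- The jumps `O` represent the fronts that emerge from an interaction with left state `a`. -/
def FrontLaw (S : HyperbolicSystem N) (P : MFTParams) (a : State N) (O : List (Jump N)) : Prop :=
  ∃ (w : Fin N → ℝ) (b : State N) (x t : ℝ) (Γ : List (Front N)), S.Widths w ∧
    Emerges S P w a b x t Γ ∧ O = Γ.map Front.toJump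

theorem Emerges.isEmission {w : Fin N → ℝ} (hw : S.Widths w) {a b : State N} {x t : ℝ}
    {A I B O : List (Front N)} (hO : Emerges S P w a b x t O) (hA : ∀ F ∈ A, F.pos t < x)
    (hI : ∀ F ∈ I, F.pos t = x) (hB : ∀ F ∈ B, x < F.pos t) (hne : I ≠ [])
    (happ : I.Pairwise (fun F G => F.speed < G.speed) → I.length ≤ 1)
    (hIw : ∀ F ∈ I, F.waves ≠ []) (hlink : Linked a (I.flatMap Front.waves) b) :
    IsEmission (FrontLaw S P) t x a (A.map Front.toJump) (I.map Front.toJump)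
      (B.map Front.toJump) (O.map Front.toJump) ∧ ∀ F ∈ O, F.waves ≠ [] := by
  have hO' := hO
  obtain ⟨l, gs, hres, hgr, hla, hsp⟩ := hO
  have hes := hres.emergingSeeds hw
  have hOw : ∀ F ∈ O, F.waves ≠ [] := fun F hF => by
    obtain ⟨G, -, h⟩ := exists_of_forall₂_right hla F hF
    exact h.waves_ne_nil
  have hlinkO : Linked a (O.flatMap Front.waves) b := by
    rw [flatMap_waves_of_launches hla, ← hgr.1]
    exact hes.linked
  obtain ⟨i1, i2⟩ := adjoined_map_toJump hIw hlink
  obtain ⟨o1, o2⟩ := adjoined_map_toJump hOw hlinkO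
  refine ⟨⟨by simpa using hA, by simpa using hI, by simpa using hB, by simpa using hne,
    by simpa [List.pairwise_map] using happ, ?_, by simpa [List.pairwise_map] using hsp, i1, o1,
    add_left_cancel (o2.trans i2.symm), w, b, x, t, O, hw, hO', rfl⟩, hOw⟩
  intro J hJ
  obtain ⟨F, hF, rfl⟩ := List.mem_map.1 hJ
  obtain ⟨G, hG, h⟩ := exists_of_forall₂_right hla F hF
  refine ⟨by rw [Front.toJump_pos, h.pos_eq], fun s hs => ?_⟩
  obtain ⟨p, hp, rfl⟩ := Option.mem_map.1 hs
  refine h.lt_of_pending (fun p hp => hes.lt_of_multi G.carrier ?_ p hp) p hp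
  rw [hgr.1]
  exact List.mem_flatMap.2 ⟨G, hG, by simp [Cluster.seeds]⟩

/-- Narrowing a front moves only its virtual center, which the associated jump ignores. -/
theorem AdjustRight.map_toJump_eq {x t : ℝ} {O B B' : List (Front N)}
    (h : AdjustRight S x t O B B') : B'.map Front.toJump = B.map Front.toJump ∧
      ((∀ F ∈ B, F.waves ≠ []) → ∀ F ∈ B', F.waves ≠ []) := by
  rcases h.1 with rfl | ⟨G, B₀, θ, rfl, -, -, -, -, -, rfl⟩
  · exact ⟨rfl, id⟩
  · refine ⟨rfl, fun h F hF => ?_⟩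
    rcases List.mem_cons.1 hF with rfl | hF
    · exact h G (by simp)
    · exact h F (by simp [hF])

theorem AdjustLeft.map_toJump_eq {x t : ℝ} {O A A' : List (Front N)}
    (h : AdjustLeft S x t O A A') : A'.map Front.toJump = A.map Front.toJump ∧
      ((∀ F ∈ A, F.waves ≠ []) → ∀ F ∈ A', F.waves ≠ []) := by
  rcases h.1 with rfl | ⟨G, A₀, θ, rfl, -, -, -, -, -, rfl⟩
  · exact ⟨rfl, id⟩
  · refine ⟨by simp only [List.map_append]; rfl, fun h F hF => ?_⟩
    rcases List.mem_append.1 hF with hF | hF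
    · exact h F (by simp [hF])
    · rw [List.mem_singleton.1 hF]
      exact h G (by simp)

theorem Step.jumpStep {t : ℝ} {Γ Γ' : List (Front N)} (h : Step S P t Γ Γ')
    (hΓ : ∀ F ∈ Γ, F.waves ≠ []) :
    JumpStep (FrontLaw S P) t (Γ.map Front.toJump) (Γ'.map Front.toJump) ∧
      ∀ F ∈ Γ', F.waves ≠ [] := by
  have hmem : ∀ {A O B : List (Front N)}, (∀ F ∈ A, F.waves ≠ []) → (∀ F ∈ O, F.waves ≠ []) →
      (∀ F ∈ B, F.waves ≠ []) → ∀ F ∈ A ++ O ++ B, F.waves ≠ [] := by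
    intro A O B h1 h2 h3 F hF
    rcases List.mem_append.1 hF with hF | hF
    · exact (List.mem_append.1 hF).elim (h1 F) (h2 F)
    · exact h3 F hF
  cases h with
  | interaction A I B A' O B' x w uL uR hA hI hB happ hlink hw hO hleft hright =>
    have hne : I ≠ [] := by
      rintro rfl
      exact happ List.Pairwise.nil
    obtain ⟨h1, h2⟩ := hO.isEmission hw.1 hA hI hB hne (fun h => absurd h happ)
      (fun F hF => hΓ F (by simp [hF])) hlink
    obtain ⟨a1, a2⟩ := hleft.map_toJump_eq
    obtain ⟨b1, b2⟩ := hright.map_toJump_eq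
    refine ⟨?_, hmem (a2 fun F hF => hΓ F (by simp [hF])) h2
      (b2 fun F hF => hΓ F (by simp [hF]))⟩
    simp only [List.map_append, a1, b1]
    exact JumpStep.emission h1
  | collapse A B A' O B' F uL uR hA hB hsimple hcomp hwidth hlink hO hleft hright =>
    obtain ⟨h1, h2⟩ := hO.isEmission (I := [F]) (fun k => ⟨le_rfl, fun _ => rfl⟩) hA (by simp) hB
      (by simp) (by simp) (fun G hG => hΓ G (by simp [List.mem_singleton.1 hG]))
      (by simpa using hlink)
    obtain ⟨a1, a2⟩ := hleft.map_toJump_eq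
    obtain ⟨b1, b2⟩ := hright.map_toJump_eq
    refine ⟨?_, hmem (a2 fun F hF => hΓ F (by simp [hF])) h2
      (b2 fun F hF => hΓ F (by simp [hF]))⟩
    have e : A ++ F :: B = A ++ [F] ++ B := by simp
    rw [e]
    simp only [List.map_append, a1, b1]
    exact JumpStep.emission h1
  | revert A B F s hF =>
    refine ⟨?_, fun G hG => ?_⟩
    · simp only [List.map_append, List.map_cons]
      refine JumpStep.redirect ?_ ?_ rfl rfl
      · simp [Front.toJump, hF]
      · simp only [Front.toJump_pos]
        simp [Front.revert, Front.pos]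
    · rcases List.mem_append.1 hG with hG | hG
      · exact hΓ G (by simp [hG])
      · rcases List.mem_cons.1 hG with rfl | hG
        · exact hΓ F (by simp)
        · exact hΓ G (by simp [hG])

/-- Weak interactions produce at most one front, and if an interaction produces several fronts then
all of these are strong. -/
theorem emissionLaw_frontLaw (hS : S.GRPSolvable) : EmissionLaw S.states (FrontLaw S P) := by
  intro K hK hKS
  obtain ⟨d, hd, hlt⟩ := S.exists_forall_chain_lt hS hK hKS P.pass_pos
  refine ⟨d, hd, ?_⟩
  rintro a _ ⟨w, b, x, t, O, hw, hO, rfl⟩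
  obtain ⟨l, gs, hres, hgr, hla, -⟩ := hO
  have hes := hres.emergingSeeds hw
  have hOw : ∀ F ∈ O, F.waves ≠ [] := fun F hF => by
    obtain ⟨G, -, h⟩ := exists_of_forall₂_right hla F hF
    exact h.waves_ne_nil
  have hlinkO : Linked a (O.flatMap Front.waves) b := by
    rw [flatMap_waves_of_launches hla, ← hgr.1]
    exact hes.linked
  obtain ⟨-, o2⟩ := adjoined_map_toJump hOw hlinkO
  rw [List.length_map, ← hla.length_eq]
  constructor
  · intro ha hsmall
    have hb : ‖b - a‖ < d := by rwa [← o2, add_sub_cancel_left]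
    -- No wave reaches the strength of a carrier, so either all waves form one composite or there
    -- are none.
    have hweak := hes.lt_pass ((hlt a ha b hb).2 w hw)
    rcases hgr.2 with h | h
    · exact h.2.1
    · rcases gs with _ | ⟨G, gs⟩
      · simp
      · have hmem : G.carrier ∈ l := by
          rw [hgr.1]
          simp [Cluster.seeds]
        exact absurd (h.1 G (by simp)).1 (hweak _ hmem).not_ge
  · intro hlen J hJ hJK
    obtain ⟨F, hF, rfl⟩ := List.mem_map.1 hJ
    obtain ⟨G, hG, hGF⟩ := exists_of_forall₂_right hla F hF
    -- With at least two fronts, the case of a lonely weak composite is excluded.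
    have hstrong := (hgr.2.resolve_left fun h => by have := h.2.1; omega).1 G hG
    obtain ⟨g₁, g₂, rfl⟩ := List.append_of_mem hG
    have hl : l = g₁.flatMap Cluster.seeds ++ G.seeds ++ g₂.flatMap Cluster.seeds := by
      rw [hgr.1]; simp
    rw [hl] at hes
    have hfam := Cluster.pairwise_family hes hstrong.2
    have hlink := hes.linked
    rw [List.map_append, List.map_append] at hlink
    obtain ⟨c, hc, -⟩ := linked_append.1 hlink
    obtain ⟨e, -, he⟩ := linked_append.1 hc
    rw [← hGF.1] at he hfam
    have hleft : F.leftState = e := F.leftState_eq he hGF.waves_ne_nil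
    change F.leftState ∈ K at hJK
    rw [hleft] at hJK
    have hcsub : c - e = F.toJump.height := by
      rw [he.eq_add_sum, add_sub_cancel_left]; rfl
    by_contra! hsmall
    -- The waves of the cluster alone solve a problem with the same widths `w`. If its outer states
    -- were close, the carrier would be weaker than `ε^{e_p}`.
    obtain ⟨ζ, u, h0, hN, hchain, hζ⟩ := HyperbolicSystem.exists_chain_of_linked hw (hKS hJK) he
      (fun γ hγ => by
        rw [hGF.1] at hγ
        obtain ⟨s, hs, rfl⟩ := List.mem_map.1 hγ
        exact hes.realizes s (by simp [hs])) hfam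
    have hcar : G.carrier.wave ∈ F.waves := by
      rw [hGF.1]
      exact List.mem_map_of_mem (by simp [Cluster.seeds])
    have := (hlt e hJK c (by rwa [hcsub])).2 w hw ζ u h0 hN hchain G.carrier.wave.family
    rw [hζ _ hcar] at this
    exact absurd hstrong.1 this.not_ge

/-! ## The initial wave sequence -/

/-- The fronts consist of waves that join `a` to `b`. -/
def FrontsJoin (a : State N) (Γ : List (Front N)) (b : State N) : Prop :=
  Linked a (Γ.flatMap Front.waves) b ∧ ∀ F ∈ Γ, F.waves ≠ []

theorem frontsJoin_nil (a : State N) : FrontsJoin a [] a := ⟨rfl, by simp⟩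

theorem FrontsJoin.append {a b c : State N} {Γ Γ' : List (Front N)} (h : FrontsJoin a Γ b)
    (h' : FrontsJoin b Γ' c) : FrontsJoin a (Γ ++ Γ') c := by
  refine ⟨?_, fun F hF => (List.mem_append.1 hF).elim (h.2 F) (h'.2 F)⟩
  rw [List.flatMap_append]
  exact linked_append.2 ⟨b, h.1, h'.1⟩

theorem InitialFan.joined {a b : State N} {x : ℝ} {Γ : List (Front N)}
    (h : InitialFan S P a b x Γ) : FrontsJoin a Γ b := by
  obtain ⟨l, hres, hla⟩ := h
  have hes := hres.emergingSeeds (fun k => ⟨le_rfl, fun _ => rfl⟩)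
  refine ⟨?_, fun F hF => ?_⟩
  · have : Γ.flatMap Front.waves = l.map Seed.wave := by
      clear hres hes
      induction hla with
      | nil => rfl
      | cons h _ ih => simp [h.1, ih, Cluster.seeds]
    rw [this]
    exact hes.linked
  · obtain ⟨s, -, h⟩ := exists_of_forall₂_right hla F hF
    exact h.waves_ne_nil

theorem InitialCell.joined {a b : State N} {x y : ℝ} {Γ : List (Front N)}
    (h : InitialCell S P a b x y Γ) : FrontsJoin a Γ b := by
  obtain ⟨w, ζ, u, z, fam, hw, -, -, -, -, rfl, rfl, hc, -, hfam, rfl⟩ := h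
  refine joins_flatten (R := FrontsJoin) frontsJoin_nil (fun _ _ _ _ _ h h' => h.append h') fun k => ?_
  rcases hfam k with ⟨h0, hk⟩ | ⟨-, F, X, τ, θ, hk, hF, -, -, hl, hr, -⟩
  · rw [hk]
    have e : u k.castSucc = u k.succ := by
      have := hc k
      rw [h0] at this
      rcases (hw k).1.eq_or_lt with h0 | h0
      · exact HyperbolicSystem.Elementary.eq_of_zero (this.1 h0.symm)
      · exact HyperbolicSystem.SimpleWave.eq_of_zero (this.2 h0)
    rw [e]
    exact frontsJoin_nil _
  · rw [hk]
    refine ⟨?_, by simp [hF]⟩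
    simp [hF, Linked, hl, hr]

/-- The fan at a grid point followed by the next cell joins the left limits of the data at
consecutive grid points. The last fan is added at the end. -/
theorem IsInitialSequence.joined {u0 : ℝ → State N} {Γ : List (Front N)}
    (h : IsInitialSequence S P u0 Γ) {a : State N} (ha : ∀ᶠ x in atBot, u0 x = a) :
    ∃ b, FrontsJoin a Γ b := by
  obtain ⟨m, x, fan, cell, -, -, hleft, -, -, hfan, hcell, rfl⟩ := h
  obtain ⟨y, hy, hya⟩ := ((eventually_lt_atBot (x 0)).and ha).exists
  have e : a = Function.leftLim u0 (x 0) := hya.symm.trans (hleft y hy)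
  refine ⟨_, FrontsJoin.append (b := Function.leftLim u0 (x (Fin.last m))) ?_
    (hfan (Fin.last m)).joined⟩
  rw [e]
  exact joins_flatten (R := FrontsJoin) frontsJoin_nil (fun _ _ _ _ _ h h' => h.append h')
    (u := fun j => Function.leftLim u0 (x j))
    fun j => (hfan j.castSucc).joined.append (hcell j).joined

end fronts

/-! ### The approximation as a history of jumps -/

namespace MFTApproximation

variable {N : ℕ} {S : HyperbolicSystem N} {P : MFTParams} (M : MFTApproximation S P)

theorem waves_ne_nil (hfin : ∀ i, M.time i < ∞) (i : ℕ) : ∀ F ∈ M.stage i, F.waves ≠ [] := by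
  induction i with
  | zero => exact (M.initial.joined M.eventually_base).choose_spec.2
  | succ i ih => exact ((M.step i (hfin _)).jumpStep ih).2

/-- The jumps of a front tracking approximation with infinitely many interactions. -/
noncomputable def toJumpTracking (hfin : ∀ i, M.time i < ∞) {T Λ : ℝ} (hT : 0 ≤ T)
    (hMT : M.timeInfty = ENNReal.ofReal T) (hΛ : ∀ i, ∀ F ∈ M.stage i, |F.speed| ≤ Λ) :
    JumpTracking N (FrontLaw S P) T Λ where
  base := M.base
  time i := (M.time i).toReal
  stage i := (M.stage i).map Front.toJump
  time_zero := by simp [M.time_zero]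
  time_one_pos := ENNReal.toReal_pos M.time_one_pos.ne' (hfin 1).ne
  monotone_time i j h := ENNReal.toReal_mono (hfin j).ne (M.time_mono h)
  time_le i := by
    refine ENNReal.toReal_le_of_le_ofReal hT ?_
    rw [← hMT]
    exact le_iSup M.time i
  exists_lt_time t ht := by
    rcases lt_or_ge t 0 with h | h
    · exact ⟨0, h.trans_le ENNReal.toReal_nonneg⟩
    · have : ENNReal.ofReal t < M.timeInfty := by
        rw [hMT]
        exact (ENNReal.ofReal_lt_ofReal_iff (h.trans_lt ht)).2 ht
      obtain ⟨i, hi⟩ := lt_iSup_iff.1 this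
      exact ⟨i, (ENNReal.ofReal_lt_iff_lt_toReal h (hfin i).ne).1 hi⟩
  adjoined_zero := by
    obtain ⟨b, h1, h2⟩ := M.initial.joined M.eventually_base
    exact (adjoined_map_toJump h2 h1).1
  sorted i t h1 h2 := by
    have ht : 0 ≤ t := ENNReal.toReal_nonneg.trans h1.le
    have := (M.quiet i t ((ENNReal.lt_ofReal_iff_toReal_lt (hfin i).ne).2 h1)
      ((ENNReal.ofReal_lt_iff_lt_toReal ht (hfin _).ne).2 h2)).1
    simpa [List.pairwise_map] using this
  step i := ((M.step i (hfin _)).jumpStep (M.waves_ne_nil hfin i)).1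
  speed_le i F hF := by
    obtain ⟨G, hG, rfl⟩ := List.mem_map.1 hF
    exact hΛ i G hG

theorem U_eq_stepValue (hfin : ∀ i, M.time i < ∞) {i : ℕ} {t : ℝ} (h1 : (M.time i).toReal ≤ t)
    (h2 : t < (M.time (i + 1)).toReal) (x : ℝ) :
    M.U x t = stepValue M.base ((M.stage i).map Front.toJump) x t := by
  have ht : 0 ≤ t := ENNReal.toReal_nonneg.trans h1
  have hi : M.index t = i := by
    have hmem : i ∈ {i : ℕ | ENNReal.ofReal t < M.time (i + 1)} :=
      (ENNReal.ofReal_lt_iff_lt_toReal ht (hfin _).ne).2 h2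
    refine le_antisymm (Nat.sInf_le hmem) (not_lt.1 fun hlt => ?_)
    have h3 : ENNReal.ofReal t < M.time (M.index t + 1) := Nat.sInf_mem ⟨i, hmem⟩
    have h4 : M.time (M.index t + 1) ≤ M.time i := M.time_mono hlt
    exact absurd (h3.trans_le h4) (not_lt.2 ((ENNReal.le_ofReal_iff_toReal_le (hfin i).ne ht).2 h1))
  rw [U, hi, stepValue, List.map_map]
  congr 3
  funext F
  simp only [Function.comp_apply, Front.toJump_pos]
  rfl

end MFTApproximation

theorem corollary5p3 {N : ℕ} (S : HyperbolicSystem N) (hS : S.GRPSolvable) (P : MFTParams)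
    (M : MFTApproximation S P)
    (Λ : ℝ) (hΛ : ∀ i, M.time i < ∞ → ∀ F ∈ M.stage i, |F.speed| ≤ Λ)
    (T : ℝ) (hT : M.timeInfty = ENNReal.ofReal T)
    (hblow : Tendsto (fun t => eVariationOn (fun x => M.U x t) univ) (𝓝[<] T) (𝓝 ∞)) :
    ∃ x : ℝ, ¬ AlphaRayCondition S.states M.U x T := by
  by_contra! hray
  have hfin : ∀ i, M.time i < ∞ := fun i =>
    (le_iSup M.time i).trans_lt (by
      change M.timeInfty < ∞
      rw [hT]
      exact ENNReal.ofReal_lt_top)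
  have hT0 : 0 < T := by
    have : 0 < M.timeInfty := M.time_one_pos.trans_le (le_iSup M.time 1)
    rwa [hT, ENNReal.ofReal_pos] at this
  -- The given bound may be negative if there are no fronts at all, while the cone argument needs a
  -- nonnegative one.
  have hΛ' : ∀ i, ∀ F ∈ M.stage i, |F.speed| ≤ max Λ 0 := fun i F hF =>
    (hΛ i (hfin i) F hF).trans (le_max_left _ _)
  let J := M.toJumpTracking hfin hT0.le hT hΛ'
  have hU : ∀ i t, J.time i ≤ t → t < J.time (i + 1) →
      ∀ x, M.U x t = stepValue J.base (J.stage i) x t :=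
    fun i t h1 h2 x => M.U_eq_stepValue hfin h1 h2 x
  obtain ⟨t₀, ht₀, R, hR⟩ := JumpTracking.exists_totalSize_le hU S.isOpen_states
    (emissionLaw_frontLaw hS) (le_max_right _ _) hT0 hray
  have hlarge : ∀ᶠ t in 𝓝[<] T, ENNReal.ofReal R < eVariationOn (fun x => M.U x t) univ :=
    hblow.eventually (eventually_gt_nhds ENNReal.ofReal_lt_top)
  have hlate : ∀ᶠ t in 𝓝[<] T, max t₀ 0 < t :=
    (eventually_gt_nhds (max_lt ht₀ hT0)).filter_mono nhdsWithin_le_nhds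
  obtain ⟨t, h1, h2, h3⟩ := (hlarge.and (hlate.and eventually_mem_nhdsWithin)).exists
  rw [max_lt_iff] at h2
  obtain ⟨i, hi, hi'⟩ := J.exists_stage h2.2.le h3
  have h4 : (fun x => M.U x t) = fun x => stepValue J.base (J.stage i) x t :=
    funext (hU i t hi hi')
  rw [h4] at h1
  exact absurd (h1.trans_le (eVariationOn_stepValue_le _ _ _))
    (not_lt.2 (ENNReal.ofReal_le_ofReal (hR i t h2.1.le hi hi')))
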